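/- Let $M$ be a smooth manifold, connected, Hausdorff and second countable, of dimension $m>1$. \textbf{Conventions.} An affine representation of a real Lie algebra $L$ on an affine space $A$ modelled on a vector space $V$ assigns to $(x,a)\in L\times A$ a vector $x.a\in V$, linear in $x$ and affine in $a$, such that $\vec{x}(y.a)-\vec{y}(x.a)-[x,y].a=0$, where $\vec{x}$ is the linear part of $a\mapsto x.a$. An affine map $f$ between affine representations $A$, $B$, with linear part $\vec f$, is intertwining if $x.f(a)=\vec f(x.a)$ for all $x,a$; $A$ and $B$ are equivalent if there is a bijective intertwining map between them. If $V$ is a linear representation of $L$, every class $c\in H^1(L,V)$ (Chevalley--Eilenberg cohomology) is an affine space modelled on the space $\partial V$ of coboundaries, where $(\partial v)(x)=x\cdot v$, and carries the affine representation $x.\gamma=\partial(\gamma(x))$. A linear representation is an affine representation on itself, and products carry the componentwise action. Let $\mathrm{Vect}(M)$ be the Lie algebra of smooth vector fields, which acts by the Lie derivative on the space $\Omega_1(M)$ of smooth $1$-forms and on the space $\mathcal S^1_2(M)$ of smooth sections of $\vee^2T^*M\otimes TM$. For $S\in\mathcal S^1_2(M)$ and $\alpha\in\Omega_1(M)$ put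 $\mathrm{tr}(S)(v)=\mathrm{trace}(w\mapsto S(w,v))$, $(\alpha\mathbf 1)(u,v)=\alpha(u)v+\alpha(v)u$ and $\mathrm{pr}(S)=S-\frac1{m+1}\mathrm{tr}(S)\mathbf 1$, and let $\overline{\mathcal S^1_2(M)}=\ker\mathrm{tr}$. Let $\mathcal C_M$ be the affine space of torsion-free linear connections on $M$, and let $\mathcal L_\nabla:X\mapsto L_X\nabla$ with $L_X\nabla(Y,Z)=[X,\nabla_YZ]-\nabla_{[X,Y]}Z-\nabla_Y[X,Z]$; this is a $1$-cocycle of $\mathrm{Vect}(M)$ with values in $\mathcal S^1_2(M)$ whose class $\mathcal L_M$ does not depend on $\nabla\in\mathcal C_M$. Let $\mathrm{pr}_\sharp\mathcal L_M\in H^1(\mathrm{Vect}(M),\overline{\mathcal S^1_2(M)})$ be the class of $\mathrm{pr}\circ\mathcal L_\nabla$, and let $\mathcal L^{\mathrm{pr}}_M\in H^1(\mathrm{Vect}(M),\mathcal S^1_2(M))$ be the class of $\mathrm{pr}\circ\mathcal L_\nabla$ viewed as a cocycle with values in $\mathcal S^1_2(M)$. Let $\mathcal P_M$ be the space of projective structures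 on $M$, that is the quotient of $\mathcal C_M$ by the relation $\nabla-\nabla'=\alpha\mathbf 1$ for some $\alpha\in\Omega_1(M)$; it is an affine space modelled on $\overline{\mathcal S^1_2(M)}$ (with $[\nabla]-[\nabla']=\mathrm{pr}(\nabla-\nabla')$) and an affine representation of $\mathrm{Vect}(M)$ by $X.[\nabla]=\mathrm{pr}(L_X\nabla)$. \textbf{Claim.} (1) The map $\nabla\mapsto\mathrm{pr}\circ\mathcal L_\nabla$ induces an affine intertwining map $g_M:\mathcal P_M\to\mathrm{pr}_\sharp\mathcal L_M$, with $g_M([\nabla])=\mathrm{pr}\circ\mathcal L_\nabla$ for all $\nabla\in\mathcal C_M$. It is natural: if $\Phi:M\to N$ is a local diffeomorphism into a manifold $N$ of the same kind and dimension and the projective structures $p\in\mathcal P_M$, $p'\in\mathcal P_N$ are $\Phi$-related (they contain connections $\nabla$, $\nabla'$ with $\nabla=\Phi^*\nabla'$), then $g_M(p)$ and $g_N(p')$ are $\Phi$-related: $g_M(p)(X)=\Phi^*\bigl(g_N(p')(X')\bigr)$ for all vector fields $X$ on $M$ and $X'$ on $N$ that are $\Phi$-related. (2) The affine representations $\mathcal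 P_M\times\Omega_1(M)$ and $\mathcal L^{\mathrm{pr}}_M$ of $\mathrm{Vect}(M)$ are equivalent. -/

import Mathlib

open scoped Manifold ContDiff Bundle Topology

noncomputable section

set_option linter.unusedSectionVars false

namespace ProjAff

section Sections

variable {E : Type*} [NormedAddCommGroup E] [NormedSpace ℝ E]
  {M : Type*} [TopologicalSpace M] [ChartedSpace E M]
  {F : Type*} [NormedAddCommGroup F] [NormedSpace ℝ F]
  {V : M → Type*} [TopologicalSpace (Bundle.TotalSpace F V)]
  [∀ x, AddCommGroup (V x)] [∀ x, Module ℝ (V x)] [∀ x : M, TopologicalSpace (V x)]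
  [FiberBundle F V] [VectorBundle ℝ F V]

/-- Smooth sections may be multiplied by smooth functions. -/
instance instSMulSection : SMul C^∞⟮𝓘(ℝ, E), M; ℝ⟯ Cₛ^∞⟮𝓘(ℝ, E); F, V⟯ :=
  ⟨fun f s => ⟨fun x => f x • s x, f.contMDiff.smul_section s.contMDiff⟩⟩

@[simp] theorem fsmul_apply (f : C^∞⟮𝓘(ℝ, E), M; ℝ⟯) (s : Cₛ^∞⟮𝓘(ℝ, E); F, V⟯) (x : M) :
    (f • s) x = f x • s x := rfl

end Sections

section Fields

variable (E : Type*) [NormedAddCommGroup E] [NormedSpace ℝ E]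
  (M : Type*) [TopologicalSpace M] [ChartedSpace E M] [IsManifold 𝓘(ℝ, E) ∞ M]

/-- The space of smooth vector fields on `M`. -/
abbrev Vect := Cₛ^∞⟮𝓘(ℝ, E); E, (TangentSpace 𝓘(ℝ, E) : M → Type _)⟯

/-- The space of smooth `1`-forms on `M`. -/
abbrev OneForm := Cₛ^∞⟮𝓘(ℝ, E); E →L[ℝ] ℝ,
  (fun x : M => TangentSpace 𝓘(ℝ, E) x →L[ℝ] Bundle.Trivial M ℝ x)⟯

/-- The space of smooth tensor fields of type `(1,2)` on `M`. -/
abbrev Tensor12 := Cₛ^∞⟮𝓘(ℝ, E); E →L[ℝ] E →L[ℝ] E, (fun x : M =>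
  TangentSpace 𝓘(ℝ, E) x →L[ℝ] TangentSpace 𝓘(ℝ, E) x →L[ℝ] TangentSpace 𝓘(ℝ, E) x)⟯

instance instTopHom (x : M) : IsTopologicalAddGroup
    (TangentSpace 𝓘(ℝ, E) x →L[ℝ] TangentSpace 𝓘(ℝ, E) x) :=
  ContinuousLinearMap.topologicalAddGroup

instance instContAddHom (x : M) : ContinuousAdd
    (TangentSpace 𝓘(ℝ, E) x →L[ℝ] TangentSpace 𝓘(ℝ, E) x) :=
  (instTopHom E M x).toContinuousAdd

instance instContSMulHom (x : M) : ContinuousSMul ℝ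
    (TangentSpace 𝓘(ℝ, E) x →L[ℝ] TangentSpace 𝓘(ℝ, E) x) :=
  ContinuousLinearMap.continuousSMul

instance instAddCommGroupTensor12 : AddCommGroup (Tensor12 E M) := ContMDiffSection.instAddCommGroup

instance instModuleTensor12 : Module ℝ (Tensor12 E M) := ContMDiffSection.instModule

variable {E M}

theorem contMDiff_trivial {f : M → ℝ} :
    ContMDiff 𝓘(ℝ, E) (𝓘(ℝ, E).prod 𝓘(ℝ, ℝ)) ∞
      (fun x => (⟨x, f x⟩ : Bundle.TotalSpace ℝ (Bundle.Trivial M ℝ))) ↔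
    ContMDiff 𝓘(ℝ, E) 𝓘(ℝ, ℝ) ∞ f := by
  constructor
  · intro h x
    have := ((Bundle.contMDiffAt_section (E := Bundle.Trivial M ℝ) x)).1 (h x)
    simpa using! this
  · intro h x
    refine ((Bundle.contMDiffAt_section (E := Bundle.Trivial M ℝ) x)).2 ?_
    simpa using! h x

/-- The derivative `Y(f)` of a smooth function along a smooth vector field. -/
def dirDeriv (Y : Vect E M) (f : C^∞⟮𝓘(ℝ, E), M; ℝ⟯) : C^∞⟮𝓘(ℝ, E), M; ℝ⟯ :=
  ⟨fun x => mvfderiv 𝓘(ℝ, E) f x (Y x), by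
    intro x
    have h1 := ((f.contMDiff.contMDiff_tangentMap (m := ∞) (by simp)).comp Y.contMDiff) x
    exact (contMDiff_snd_tangentBundle_modelSpace ℝ 𝓘(ℝ, ℝ)).contMDiffAt.comp x h1⟩

/-- The function `α(Y)`. -/
def OneForm.eval (α : OneForm E M) (Y : Vect E M) : C^∞⟮𝓘(ℝ, E), M; ℝ⟯ :=
  ⟨fun x => α x (Y x), contMDiff_trivial.1 (ContMDiff.clm_bundle_apply (b := id)
    α.contMDiff Y.contMDiff)⟩

/-- The vector field `S(Y, Z)`. -/
def Tensor12.eval (S : Tensor12 E M) (Y Z : Vect E M) : Vect E M :=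
  ⟨fun x => S x (Y x) (Z x), ContMDiff.clm_bundle_apply₂ (b := id) S.contMDiff Y.contMDiff Z.contMDiff⟩

variable [CompleteSpace E]

instance instBracket : Bracket (Vect E M) (Vect E M) :=
  ⟨fun X Y => ⟨VectorField.mlieBracket 𝓘(ℝ, E) X Y, by
    have : IsManifold 𝓘(ℝ, E) (((⊤ : ℕ∞) : ℕ∞ω) + 1) M := by simpa using ‹IsManifold 𝓘(ℝ, E) ∞ M›
    have : IsManifold 𝓘(ℝ, E) (minSmoothness ℝ 2) M := by
      rw [minSmoothness_of_isRCLikeNormedField]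
      infer_instance
    exact ContDiff.mlieBracket_vectorField (m := ⊤) (n := ⊤) X.contMDiff Y.contMDiff (by simp)⟩⟩

theorem bracket_apply (X Y : Vect E M) (x : M) :
    ⁅X, Y⁆ x = VectorField.mlieBracket 𝓘(ℝ, E) X Y x := rfl

theorem bracket_coe (X Y : Vect E M) :
    ⇑⁅X, Y⁆ = VectorField.mlieBracket 𝓘(ℝ, E) X Y := rfl

instance instLieRing : LieRing (Vect E M) where
  add_lie X Y Z := by
    ext x
    exact VectorField.mlieBracket_add_left X.mdifferentiableAt Y.mdifferentiableAt
  lie_add X Y Z := by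
    ext x
    exact VectorField.mlieBracket_add_right Y.mdifferentiableAt Z.mdifferentiableAt
  lie_self X := by
    ext x
    simp [bracket_apply]
  leibniz_lie X Y Z := by
    ext x
    have : IsManifold 𝓘(ℝ, E) (minSmoothness ℝ 3) M := by
      rw [minSmoothness_of_isRCLikeNormedField]
      exact IsManifold.of_le (n := ∞) (by simpa using (WithTop.coe_le_coe.2 (le_top : (3 : ℕ∞) ≤ ⊤)))
    have h : ∀ W : Vect E M, ContMDiffAt 𝓘(ℝ, E) (𝓘(ℝ, E).tangent) (minSmoothness ℝ 2)
        (fun x => (W x : TangentBundle 𝓘(ℝ, E) M)) x :=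
      fun W => (W.contMDiff x).of_le (by
        rw [minSmoothness_of_isRCLikeNormedField]
        simpa using (WithTop.coe_le_coe.2 (le_top : (2 : ℕ∞) ≤ ⊤)))
    exact VectorField.leibniz_identity_mlieBracket_apply (h X) (h Y) (h Z)

instance instLieAlgebra : LieAlgebra ℝ (Vect E M) where
  lie_smul c X Y := by
    ext x
    exact VectorField.mlieBracket_const_smul_right Y.mdifferentiableAt

theorem dirDeriv_apply (Y : Vect E M) (f : C^∞⟮𝓘(ℝ, E), M; ℝ⟯) (x : M) :
    dirDeriv Y f x = mvfderiv 𝓘(ℝ, E) f x (Y x) := rfl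

theorem bracket_fsmul (X Y : Vect E M) (f : C^∞⟮𝓘(ℝ, E), M; ℝ⟯) :
    ⁅X, f • Y⁆ = dirDeriv X f • Y + f • ⁅X, Y⁆ := by
  ext x
  exact VectorField.mlieBracket_smul_right (f.contMDiff.mdifferentiable (by simp) x) Y.mdifferentiableAt

theorem fsmul_bracket (X Y : Vect E M) (f : C^∞⟮𝓘(ℝ, E), M; ℝ⟯) :
    ⁅f • X, Y⁆ = - (dirDeriv Y f • X) + f • ⁅X, Y⁆ := by
  ext x
  refine (VectorField.mlieBracket_smul_left (f.contMDiff.mdifferentiable (by simp) x) X.mdifferentiableAt).trans ?_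
  simp [dirDeriv_apply, bracket_apply]

end Fields
section Frame

variable {E : Type*} [NormedAddCommGroup E] [NormedSpace ℝ E] [FiniteDimensional ℝ E]
  {M : Type*} [TopologicalSpace M] [ChartedSpace E M] [IsManifold 𝓘(ℝ, E) ∞ M] [T2Space M]

/-- Around every point there are a cut-off function `ψ`, smooth vector fields `e i` and smooth
one-forms `θ i` such that `ψ(y) v = ∑ i, θ i (v) e i` for every tangent vector `v` at `y`. -/
theorem exists_frame (x : M) : ∃ (ψ : C^∞⟮𝓘(ℝ, E), M; ℝ⟯)
    (e : Fin (Module.finrank ℝ E) → Vect E M)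
    (θ : Fin (Module.finrank ℝ E) → Vect E M → C^∞⟮𝓘(ℝ, E), M; ℝ⟯)
    (t : Fin (Module.finrank ℝ E) → (y : M) → (TangentSpace 𝓘(ℝ, E) y →ₗ[ℝ] ℝ)),
    (∀ᶠ y in 𝓝 x, ψ y = 1) ∧ (∀ i Y y, θ i Y y = t i y (Y y)) ∧
    ∀ (y : M) (v : TangentSpace 𝓘(ℝ, E) y), ψ y • v = ∑ i, t i y v • e i y := by
  classical
  let b := Module.finBasis ℝ E
  let τ := trivializationAt E (TangentSpace 𝓘(ℝ, E) : M → Type _) x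
  have hτ : τ.baseSet = (chartAt E x).source := TangentBundle.trivializationAt_baseSet x
  obtain ⟨φ⟩ : Nonempty (SmoothBumpFunction 𝓘(ℝ, E) x) := inferInstance
  have hsupp : tsupport φ ⊆ τ.baseSet := by
    rw [hτ]; exact φ.tsupport_subset_chartAt_source
  have hφ0 : ∀ y, y ∉ τ.baseSet → φ y = 0 := fun y hy =>
    image_eq_zero_of_notMem_tsupport fun h => hy (hsupp h)
  let φ' : C^∞⟮𝓘(ℝ, E), M; ℝ⟯ := ⟨φ, φ.contMDiff⟩
  have hφφ : ∀ y, (φ' * φ') y = φ y * φ y := fun _ => rfl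
  refine ⟨φ' * φ', fun i => ⟨fun y => φ y • τ.localFrame b i y, ?_⟩,
    fun i Y => ⟨fun y => φ y * τ.localFrameCoeff 𝓘(ℝ, E) b i y (Y y), ?_⟩,
    fun i y => φ y • τ.localFrameCoeff 𝓘(ℝ, E) b i y, ?_, ?_, ?_⟩
  · exact ContMDiffOn.smul_section_of_tsupport φ.contMDiff.contMDiffOn τ.open_baseSet hsupp
      (τ.contMDiffOn_localFrame_baseSet ∞ b i)
  · intro y
    by_cases hy : y ∈ tsupport φ
    · exact (φ.contMDiff y).mul (contMDiffAt_localFrameCoeff b (hsupp hy) (Y.contMDiff y) i)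
    · have : (fun y => φ y * τ.localFrameCoeff 𝓘(ℝ, E) b i y (Y y)) =ᶠ[𝓝 y] fun _ => 0 := by
        filter_upwards [(isClosed_tsupport φ).isOpen_compl.mem_nhds hy] with z hz
        rw [image_eq_zero_of_notMem_tsupport hz, zero_mul]
      exact contMDiffAt_const.congr_of_eventuallyEq this
  · filter_upwards [φ.eventuallyEq_one] with y hy
    have : φ y = 1 := hy
    simp [hφφ, this]
  · intro i Y y
    rfl
  · intro y v
    by_cases hy : y ∈ τ.baseSet
    · have := τ.eq_sum_localFrameCoeff_smul (I := 𝓘(ℝ, E)) (b := b)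
        (s := Function.update 0 y v) hy
      simp only [Function.update_self] at this
      conv_lhs => rw [this, Finset.smul_sum]
      refine Finset.sum_congr rfl fun i _ => ?_
      rw [hφφ, LinearMap.smul_apply, smul_smul, smul_eq_mul]
      change _ = (φ y * _) • (φ y • τ.localFrame b i y)
      rw [smul_smul]
      congr 1
      ring
    · simp [hφφ, hφ0 y hy]

/-- The local frame given by the trivialization at `x` extends, near `x`, to global fields. -/
theorem exists_localFrame (x : M) (i : Fin (Module.finrank ℝ E)) : ∃ Y : Vect E M, ∀ᶠ y in 𝓝 x,
    Y y = (trivializationAt E (TangentSpace 𝓘(ℝ, E) : M → Type _) x).localFrame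
      (Module.finBasis ℝ E) i y := by
  let τ := trivializationAt E (TangentSpace 𝓘(ℝ, E) : M → Type _) x
  have hτ : τ.baseSet = (chartAt E x).source := TangentBundle.trivializationAt_baseSet x
  obtain ⟨φ⟩ : Nonempty (SmoothBumpFunction 𝓘(ℝ, E) x) := inferInstance
  refine ⟨⟨fun y => φ y • τ.localFrame (Module.finBasis ℝ E) i y,
    ContMDiffOn.smul_section_of_tsupport φ.contMDiff.contMDiffOn τ.open_baseSet
      (hτ ▸ φ.tsupport_subset_chartAt_source)
      (τ.contMDiffOn_localFrame_baseSet ∞ (Module.finBasis ℝ E) i)⟩, ?_⟩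
  filter_upwards [φ.eventuallyEq_one] with y hy
  have : φ y = 1 := hy
  simp [this, τ]

theorem exists_vect (x : M) (v : TangentSpace 𝓘(ℝ, E) x) : ∃ Y : Vect E M, Y x = v := by
  obtain ⟨ψ, e, θ, t, h1, -, h3⟩ := exists_frame (E := E) x
  refine ⟨∑ i, (t i x v) • e i, ?_⟩
  have := h3 x v
  rw [h1.self_of_nhds, one_smul] at this
  conv_rhs => rw [this]
  have h : ∀ Y : Vect E M, Y x = (ContMDiffSection.coeAddHom 𝓘(ℝ, E) E ∞
    (TangentSpace 𝓘(ℝ, E) : M → Type _) Y) x := fun _ => rfl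
  rw [h, map_sum, Finset.sum_apply]
  rfl

/-- A chosen smooth vector field with a given value at a given point. -/
def extend (x : M) (v : TangentSpace 𝓘(ℝ, E) x) : Vect E M := (exists_vect x v).choose

theorem extend_self (x : M) (v : TangentSpace 𝓘(ℝ, E) x) : extend x v x = v :=
  (exists_vect x v).choose_spec

variable {F : Type*} [NormedAddCommGroup F] [NormedSpace ℝ F]
  {V : M → Type*} [TopologicalSpace (Bundle.TotalSpace F V)]
  [∀ x, AddCommGroup (V x)] [∀ x, Module ℝ (V x)] [∀ x : M, TopologicalSpace (V x)]
  [FiberBundle F V] [VectorBundle ℝ F V]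

/-- A `C^∞(M)`-linear map from vector fields to sections depends on the field only pointwise. -/
theorem pointwise (T : Vect E M → Cₛ^∞⟮𝓘(ℝ, E); F, V⟯) (hadd : ∀ Y Z, T (Y + Z) = T Y + T Z)
    (hsmul : ∀ (f : C^∞⟮𝓘(ℝ, E), M; ℝ⟯) Y, T (f • Y) = f • T Y) {Y Z : Vect E M} {x : M}
    (h : Y x = Z x) : T Y x = T Z x := by
  obtain ⟨ψ, e, θ, t, h1, h2, h3⟩ := exists_frame (E := E) x
  let A : Vect E M →+ V x :=
    { toFun := fun Y => T Y x
      map_zero' := by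
        have := hsmul 0 0
        have h0 : ((0 : C^∞⟮𝓘(ℝ, E), M; ℝ⟯) • (0 : Vect E M)) = 0 := by ext; simp
        rw [h0] at this
        rw [this]; simp
      map_add' := fun Y Z => by rw [hadd]; rfl }
  have key : ∀ W : Vect E M, T W x = ∑ i, t i x (W x) • T (e i) x := by
    intro W
    have hW : ψ • W = ∑ i, θ i W • e i := by
      ext y
      have h : ∀ Y : Vect E M, Y y = (ContMDiffSection.coeAddHom 𝓘(ℝ, E) E ∞
        (TangentSpace 𝓘(ℝ, E) : M → Type _) Y) y := fun _ => rfl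
      rw [h (∑ i, θ i W • e i), map_sum, Finset.sum_apply, fsmul_apply, h3]
      refine Finset.sum_congr rfl fun i _ => ?_
      rw [← h2]
      rfl
    have hx : T (ψ • W) x = T W x := by
      rw [hsmul, fsmul_apply, h1.self_of_nhds, one_smul]
    rw [← hx, hW]
    change A _ = _
    rw [map_sum]
    refine Finset.sum_congr rfl fun i _ => ?_
    change T _ x = _
    rw [hsmul, fsmul_apply, h2]
  rw [key, key, h]

variable [∀ x, IsTopologicalAddGroup (V x)] [∀ x, ContinuousSMul ℝ (V x)]

/-- The constant function `c` as a smooth function. -/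
def constFun (c : ℝ) : C^∞⟮𝓘(ℝ, E), M; ℝ⟯ := ⟨fun _ => c, contMDiff_const⟩

@[simp] theorem constFun_apply (c : ℝ) (x : M) :
    (constFun c : C^∞⟮𝓘(ℝ, E), M; ℝ⟯) x = c := rfl

/-- The value at a point of a `C^∞(M)`-linear map from vector fields to sections. -/
def mkHomAt (T : Vect E M → Cₛ^∞⟮𝓘(ℝ, E); F, V⟯) (hadd : ∀ Y Z, T (Y + Z) = T Y + T Z)
    (hsmul : ∀ (f : C^∞⟮𝓘(ℝ, E), M; ℝ⟯) Y, T (f • Y) = f • T Y) (x : M) :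
    TangentSpace 𝓘(ℝ, E) x →L[ℝ] V x :=
  haveI : FiniteDimensional ℝ (TangentSpace 𝓘(ℝ, E) x) := inferInstanceAs (FiniteDimensional ℝ E)
  haveI : T2Space (TangentSpace 𝓘(ℝ, E) x) := inferInstanceAs (T2Space E)
  LinearMap.toContinuousLinearMap
  { toFun := fun v => T (extend x v) x
    map_add' := fun v w => by
      have : T (extend x (v + w)) x = T (extend x v + extend x w) x :=
        pointwise T hadd hsmul (by simp [extend_self])
      rw [this, hadd]; rfl
    map_smul' := fun c v => by
      have : T (extend x (c • v)) x = T ((constFun c : C^∞⟮𝓘(ℝ, E), M; ℝ⟯) • extend x v) x :=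
        pointwise T hadd hsmul (by simp [extend_self])
      rw [this, hsmul]; rfl }

theorem mkHomAt_apply (T : Vect E M → Cₛ^∞⟮𝓘(ℝ, E); F, V⟯) (hadd : ∀ Y Z, T (Y + Z) = T Y + T Z)
    (hsmul : ∀ (f : C^∞⟮𝓘(ℝ, E), M; ℝ⟯) Y, T (f • Y) = f • T Y) (Y : Vect E M) (x : M) :
    mkHomAt T hadd hsmul x (Y x) = T Y x :=
  pointwise T hadd hsmul (extend_self x _)

theorem contMDiff_hom (L : (x : M) → (TangentSpace 𝓘(ℝ, E) x →L[ℝ] V x))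
    (T : Vect E M → Cₛ^∞⟮𝓘(ℝ, E); F, V⟯) (hL : ∀ x (Y : Vect E M), L x (Y x) = T Y x) :
    ContMDiff 𝓘(ℝ, E) (𝓘(ℝ, E).prod 𝓘(ℝ, E →L[ℝ] F)) ∞ (fun x =>
      (⟨x, L x⟩ : Bundle.TotalSpace (E →L[ℝ] F)
        (fun x : M => TangentSpace 𝓘(ℝ, E) x →L[ℝ] V x))) := by
  intro x
  rw [contMDiffAt_hom_bundle]
  refine ⟨contMDiffAt_id, ?_⟩
  let b := Module.finBasis ℝ E
  let τ := trivializationAt E (TangentSpace 𝓘(ℝ, E) : M → Type _) x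
  choose g hg using exists_localFrame (E := E) x
  let σ := trivializationAt F V x
  let Φ : (Fin (Module.finrank ℝ E) → F) →L[ℝ] (E →L[ℝ] F) :=
    ∑ j, (ContinuousLinearMap.smulRightL ℝ E F (LinearMap.toContinuousLinearMap (b.coord j))).comp
      (ContinuousLinearMap.proj j)
  have h1 : ContMDiffAt 𝓘(ℝ, E) 𝓘(ℝ, Fin (Module.finrank ℝ E) → F) ∞
      (fun y j => (σ ⟨y, T (g j) y⟩).2) x := by
    rw [contMDiffAt_pi_space]
    intro j
    exact (Bundle.contMDiffAt_section x).1 ((T (g j)).contMDiff x)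
  have h2 := (Φ.contMDiff (n := ∞)).contMDiffAt.comp x h1
  refine h2.congr_of_eventuallyEq ?_
  have hτ : τ.baseSet ∈ 𝓝 x := τ.open_baseSet.mem_nhds (FiberBundle.mem_baseSet_trivializationAt _ _ _)
  have hσ : σ.baseSet ∈ 𝓝 x := σ.open_baseSet.mem_nhds (FiberBundle.mem_baseSet_trivializationAt _ _ _)
  filter_upwards [hτ, hσ, Filter.eventually_all.2 hg] with y hy1 hy2 hy3
  apply ContinuousLinearMap.coe_injective
  apply b.ext
  intro i
  have h4 : (Φ fun j => (σ ⟨y, T (g j) y⟩).2) (b i) = (σ ⟨y, T (g i) y⟩).2 := by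
    simp [Φ, Finsupp.single_apply]
  change _ = (Φ fun j => (σ ⟨y, T (g j) y⟩).2) (b i)
  rw [h4, ← hL, hy3, τ.localFrame_apply_of_mem_baseSet b hy1]
  change σ.continuousLinearMapAt ℝ y (L y (τ.symmL ℝ y (b i))) = _
  rw [Bundle.Trivialization.continuousLinearMapAt_apply, Bundle.Trivialization.coe_linearMapAt_of_mem _ hy2]
  have h5 : τ.symmL ℝ y (b i) = τ.basisAt b hy1 i := by
    rw [Bundle.Trivialization.basisAt, Module.Basis.map_apply,
      Bundle.Trivialization.symmL_apply _ hy1]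
    rfl
  rw [h5]

variable [ContMDiffVectorBundle ∞ F V 𝓘(ℝ, E)]

/-- The smooth section of `Hom(TM, V)` given by a `C^∞(M)`-linear map from vector fields to
sections of `V`. -/
def mkHom (T : Vect E M → Cₛ^∞⟮𝓘(ℝ, E); F, V⟯) (hadd : ∀ Y Z, T (Y + Z) = T Y + T Z)
    (hsmul : ∀ (f : C^∞⟮𝓘(ℝ, E), M; ℝ⟯) Y, T (f • Y) = f • T Y) :
    Cₛ^∞⟮𝓘(ℝ, E); E →L[ℝ] F, (fun x : M => TangentSpace 𝓘(ℝ, E) x →L[ℝ] V x)⟯ :=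
  ⟨mkHomAt T hadd hsmul, contMDiff_hom _ T fun x Y => mkHomAt_apply T hadd hsmul Y x⟩

theorem mkHom_apply (T : Vect E M → Cₛ^∞⟮𝓘(ℝ, E); F, V⟯) (hadd : ∀ Y Z, T (Y + Z) = T Y + T Z)
    (hsmul : ∀ (f : C^∞⟮𝓘(ℝ, E), M; ℝ⟯) Y, T (f • Y) = f • T Y) (Y : Vect E M) (x : M) :
    mkHom T hadd hsmul x (Y x) = T Y x :=
  mkHomAt_apply T hadd hsmul Y x

end Frame
section AffineRepresentations

variable (L : Type*) [LieRing L] [LieAlgebra ℝ L]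

/-- An affine representation of the real Lie algebra `L` on the affine space `A` modelled on `V`:
each `x : L` acts by an affine map `a ↦ x.a` from `A` to `V`. -/
structure AffineRep (V A : Type*) [AddCommGroup V] [Module ℝ V] [AddTorsor V A] where
  act : L →ₗ[ℝ] (A →ᵃ[ℝ] V)
  act_lie : ∀ (x y : L) (a : A),
    (act x).linear (act y a) - (act y).linear (act x a) - act ⁅x, y⁆ a = 0

namespace AffineRep

variable {L} {V A W B : Type*} [AddCommGroup V] [Module ℝ V] [AddTorsor V A]
  [AddCommGroup W] [Module ℝ W] [AddTorsor W B]

/-- Intertwining maps between affine representations. -/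
def IsIntertwining (α : AffineRep L V A) (β : AffineRep L W B) (f : A →ᵃ[ℝ] B) : Prop :=
  ∀ (x : L) (a : A), β.act x (f a) = f.linear (α.act x a)

/-- Two affine representations are equivalent if there is a bijective intertwining map. -/
def Equivalent (α : AffineRep L V A) (β : AffineRep L W B) : Prop :=
  ∃ f : A →ᵃ[ℝ] B, Function.Bijective f ∧ IsIntertwining α β f

/-- The direct sum of two affine representations. -/
def prod (α : AffineRep L V A) (β : AffineRep L W B) : AffineRep L (V × W) (A × B) where
  act :=
    { toFun := fun x =>
        { toFun := fun p => (α.act x p.1, β.act x p.2)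
          linear := (α.act x).linear.prodMap (β.act x).linear
          map_vadd' := by intro p v; ext <;> simp }
      map_add' := by intro x y; ext p <;> simp
      map_smul' := by intro c x; ext p <;> simp }
  act_lie x y a := by
    ext
    · exact α.act_lie x y a.1
    · exact β.act_lie x y a.2

variable (L V) in
/-- A linear representation, seen as an affine representation on its underlying affine space. -/
def ofLieModule [LieRingModule L V] [LieModule ℝ L V] : AffineRep L V V where
  act :=
    { toFun := fun x => (LieModule.toEnd ℝ L V x).toAffineMap
      map_add' := by intro x y; ext v; simp
      map_smul' := by intro c x; ext v; simp }
  act_lie x y a := by simp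

end AffineRep

end AffineRepresentations

section Cohomology

variable (L : Type*) [LieRing L] [LieAlgebra ℝ L]
  (V : Type*) [AddCommGroup V] [Module ℝ V] [LieRingModule L V] [LieModule ℝ L V]

/-- The coboundary `∂v : x ↦ x • v` of a `0`-cochain. -/
def coboundary₀ : V →ₗ[ℝ] (L →ₗ[ℝ] V) := (LieModule.toEnd ℝ L V : L →ₗ[ℝ] V →ₗ[ℝ] V).flip

/-- The space of `1`-cocycles. -/
def oneCocycle : Submodule ℝ (L →ₗ[ℝ] V) := LinearMap.ker (LieModule.Cohomology.d₁₂ ℝ L V)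

/-- The space of `1`-coboundaries. -/
def oneCoboundary : Submodule ℝ (L →ₗ[ℝ] V) := LinearMap.range (coboundary₀ L V)

/-- The first Chevalley-Eilenberg cohomology space. -/
abbrev H1 := oneCocycle L V ⧸ (oneCoboundary L V).submoduleOf (oneCocycle L V)

variable {L V}

theorem coboundary₀_apply (v : V) (x : L) : coboundary₀ L V v x = ⁅x, v⁆ := rfl

theorem mem_oneCocycle {γ : L →ₗ[ℝ] V} :
    γ ∈ oneCocycle L V ↔ ∀ x y, ⁅x, γ y⁆ - ⁅y, γ x⁆ - γ ⁅x, y⁆ = 0 := by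
  rw [oneCocycle, LinearMap.mem_ker]
  constructor
  · intro h x y
    rw [← LieModule.Cohomology.d₁₂_apply_apply, h]
    rfl
  · intro h
    ext x y
    exact h x y

theorem oneCoboundary_le : oneCoboundary L V ≤ oneCocycle L V := by
  rintro _ ⟨v, rfl⟩
  rw [mem_oneCocycle]
  intro x y
  simp [coboundary₀_apply]

/-- The cohomology class of a cocycle. -/
def H1.mk (γ : oneCocycle L V) : H1 L V := Submodule.Quotient.mk γ

theorem H1.mk_eq_mk {γ γ' : oneCocycle L V} :
    H1.mk γ = H1.mk γ' ↔ ((γ : L →ₗ[ℝ] V) - γ') ∈ oneCoboundary L V :=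
  Submodule.Quotient.eq _

/-- The affine space of all cocycles in the cohomology class `c`. -/
def CocycleClass (c : H1 L V) : Type _ := {γ : oneCocycle L V // H1.mk γ = c}

/-- The cochain underlying an element of a cohomology class. -/
def CocycleClass.cochain {c : H1 L V} (γ : CocycleClass c) : L →ₗ[ℝ] V := γ.1.1

/-- A cohomology class is an affine space modelled on the space of coboundaries. -/
instance instAddTorsorCocycleClass (c : H1 L V) : AddTorsor (oneCoboundary L V) (CocycleClass c) where
  vadd β γ := ⟨⟨β.1 + γ.1.1, add_mem (oneCoboundary_le β.2) γ.1.2⟩, by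
    refine (H1.mk_eq_mk.2 ?_).trans γ.2
    simp⟩
  zero_vadd γ := by
    apply Subtype.ext; apply Subtype.ext
    exact zero_add γ.1.1
  add_vadd β β' γ := by
    apply Subtype.ext; apply Subtype.ext
    exact add_assoc β.1 β'.1 γ.1.1
  vsub γ γ' := ⟨γ.1.1 - γ'.1.1, H1.mk_eq_mk.1 (γ.2.trans γ'.2.symm)⟩
  nonempty := by
    obtain ⟨γ, rfl⟩ := Submodule.Quotient.mk_surjective _ c
    exact ⟨⟨γ, rfl⟩⟩
  vsub_vadd' γ γ' := by
    apply Subtype.ext; apply Subtype.ext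
    exact sub_add_cancel γ.1.1 γ'.1.1
  vadd_vsub' β γ := by
    apply Subtype.ext
    exact add_sub_cancel_right β.1 γ.1.1

/-- The canonical affine representation of `L` on a cohomology class: `x.γ = ∂(γ(x))`. -/
def classRep (c : H1 L V) : AffineRep L (oneCoboundary L V) (CocycleClass c) where
  act :=
    { toFun := fun x =>
        { toFun := fun γ => (coboundary₀ L V).rangeRestrict (γ.cochain x)
          linear := ((coboundary₀ L V).rangeRestrict ∘ₗ LinearMap.applyₗ x) ∘ₗ
            (oneCoboundary L V).subtype
          map_vadd' := fun γ β => by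
            apply Subtype.ext
            change coboundary₀ L V (β.1 x + γ.cochain x) = _
            rw [map_add]
            rfl }
      map_add' := fun x y => by
        apply AffineMap.ext
        intro γ
        exact (congrArg (coboundary₀ L V).rangeRestrict (map_add γ.cochain x y)).trans
          (map_add (coboundary₀ L V).rangeRestrict _ _)
      map_smul' := fun r x => by
        apply AffineMap.ext
        intro γ
        exact (congrArg (coboundary₀ L V).rangeRestrict (map_smul γ.cochain r x)).trans
          (map_smul (coboundary₀ L V).rangeRestrict _ _) }
  act_lie x y γ := by
    have h := mem_oneCocycle.1 γ.1.2 x y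
    apply Subtype.ext
    change coboundary₀ L V ⁅x, γ.cochain y⁆ - coboundary₀ L V ⁅y, γ.cochain x⁆ -
      coboundary₀ L V (γ.cochain ⁅x, y⁆) = 0
    rw [← map_sub, ← map_sub]
    change coboundary₀ L V (⁅x, γ.1.1 y⁆ - ⁅y, γ.1.1 x⁆ - γ.1.1 ⁅x, y⁆) = 0
    rw [h, map_zero]

variable {W : Type*} [AddCommGroup W] [Module ℝ W] [LieRingModule L W] [LieModule ℝ L W]

/-- The composition of a cocycle with an equivariant linear map. -/
def cocycleMap (T : V →ₗ⁅ℝ, L⁆ W) : oneCocycle L V →ₗ[ℝ] oneCocycle L W where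
  toFun γ := ⟨(T : V →ₗ[ℝ] W) ∘ₗ γ.1, by
    have hγ := γ.2
    rw [mem_oneCocycle] at hγ ⊢
    intro x y
    have h := congrArg T (hγ x y)
    rw [map_sub, map_sub, LieModuleHom.map_lie, LieModuleHom.map_lie, map_zero] at h
    exact h⟩
  map_add' γ γ' := by
    apply Subtype.ext
    exact LinearMap.comp_add _ _ _
  map_smul' c γ := by
    apply Subtype.ext
    exact LinearMap.comp_smul _ _ _

/-- The map induced in cohomology by an equivariant linear map. -/
def H1.map (T : V →ₗ⁅ℝ, L⁆ W) : H1 L V →ₗ[ℝ] H1 L W :=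
  Submodule.mapQ _ _ (cocycleMap T) (by
    rintro γ ⟨v, hv⟩
    refine ⟨T v, ?_⟩
    ext x
    have h := congrArg T (LinearMap.congr_fun hv x)
    exact (LieModuleHom.map_lie T x v).symm.trans h)

theorem H1.map_mk (T : V →ₗ⁅ℝ, L⁆ W) (γ : oneCocycle L V) :
    H1.map T (H1.mk γ) = H1.mk (cocycleMap T γ) := rfl

end Cohomology
section Module

variable {E : Type*} [NormedAddCommGroup E] [NormedSpace ℝ E]
  {M : Type*} [TopologicalSpace M] [ChartedSpace E M]
  {F : Type*} [NormedAddCommGroup F] [NormedSpace ℝ F]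
  {V : M → Type*} [TopologicalSpace (Bundle.TotalSpace F V)]
  [∀ x, AddCommGroup (V x)] [∀ x, Module ℝ (V x)] [∀ x : M, TopologicalSpace (V x)]
  [FiberBundle F V] [VectorBundle ℝ F V]

instance instModuleSection : Module C^∞⟮𝓘(ℝ, E), M; ℝ⟯ Cₛ^∞⟮𝓘(ℝ, E); F, V⟯ where
  one_smul s := by ext x; exact one_smul ℝ (s x)
  mul_smul f g s := by ext x; exact mul_smul (f x) (g x) (s x)
  smul_zero f := by ext x; exact smul_zero (f x)
  smul_add f s t := by ext x; exact smul_add (f x) (s x) (t x)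
  add_smul f g s := by ext x; exact add_smul (f x) (g x) (s x)
  zero_smul s := by ext x; exact zero_smul ℝ (s x)

theorem section_sum_apply {ι : Type*} (t : Finset ι) (s : ι → Cₛ^∞⟮𝓘(ℝ, E); F, V⟯) (x : M) :
    (∑ i ∈ t, s i) x = ∑ i ∈ t, s i x := by
  have h : ∀ s : Cₛ^∞⟮𝓘(ℝ, E); F, V⟯, s x = (ContMDiffSection.coeAddHom 𝓘(ℝ, E) F ∞ V s) x :=
    fun _ => rfl
  rw [h, map_sum, Finset.sum_apply]
  rfl

theorem fun_sum_apply {ι : Type*} (t : Finset ι) (s : ι → C^∞⟮𝓘(ℝ, E), M; ℝ⟯) (x : M) :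
    (∑ i ∈ t, s i) x = ∑ i ∈ t, s i x := by
  have h : ∀ s : C^∞⟮𝓘(ℝ, E), M; ℝ⟯, s x = (ContMDiffMap.coeFnAddMonoidHom (I := 𝓘(ℝ, E))
    (I' := 𝓘(ℝ, ℝ)) (N := M) (G := ℝ) (n := ∞) s) x := fun _ => rfl
  rw [h, map_sum, Finset.sum_apply]
  rfl

end Module

section Derivations

variable {E : Type*} [NormedAddCommGroup E] [NormedSpace ℝ E]
  {M : Type*} [TopologicalSpace M] [ChartedSpace E M] [IsManifold 𝓘(ℝ, E) ∞ M]

theorem dirDeriv_add (X : Vect E M) (f g : C^∞⟮𝓘(ℝ, E), M; ℝ⟯) :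
    dirDeriv X (f + g) = dirDeriv X f + dirDeriv X g := by
  ext x
  have := congrArg (fun l => l (X x)) (mvfderiv_add (I := 𝓘(ℝ, E))
    (f.contMDiff.mdifferentiable (by simp) x) (g.contMDiff.mdifferentiable (by simp) x))
  exact this

theorem dirDeriv_mul (X : Vect E M) (f g : C^∞⟮𝓘(ℝ, E), M; ℝ⟯) :
    dirDeriv X (f * g) = f * dirDeriv X g + g * dirDeriv X f := by
  ext x
  have := congrArg (fun l => l (X x)) (mvfderiv_mul (I := 𝓘(ℝ, E))
    (f.contMDiff.mdifferentiable (by simp) x) (g.contMDiff.mdifferentiable (by simp) x))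
  exact this

theorem add_dirDeriv (X Y : Vect E M) (f : C^∞⟮𝓘(ℝ, E), M; ℝ⟯) :
    dirDeriv (X + Y) f = dirDeriv X f + dirDeriv Y f := by
  ext x
  exact map_add (mvfderiv 𝓘(ℝ, E) f x) (X x) (Y x)

theorem fsmul_dirDeriv (g : C^∞⟮𝓘(ℝ, E), M; ℝ⟯) (X : Vect E M) (f : C^∞⟮𝓘(ℝ, E), M; ℝ⟯) :
    dirDeriv (g • X) f = g * dirDeriv X f := by
  ext x
  exact map_smul (mvfderiv 𝓘(ℝ, E) f x) (g x) (X x)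

theorem dirDeriv_const (X : Vect E M) (c : ℝ) :
    dirDeriv X (⟨fun _ => c, contMDiff_const⟩ : C^∞⟮𝓘(ℝ, E), M; ℝ⟯) = 0 := by
  ext x
  change mvfderiv 𝓘(ℝ, E) (fun _ : M => c) x (X x) = 0
  rw [mvfderiv_const]
  rfl

/-- The derivative along a vector field, as an additive map. -/
def dirDerivHom (X : Vect E M) : C^∞⟮𝓘(ℝ, E), M; ℝ⟯ →+ C^∞⟮𝓘(ℝ, E), M; ℝ⟯ :=
  AddMonoidHom.mk' (dirDeriv X) (dirDeriv_add X)

theorem dirDeriv_sub (X : Vect E M) (f g : C^∞⟮𝓘(ℝ, E), M; ℝ⟯) :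
    dirDeriv X (f - g) = dirDeriv X f - dirDeriv X g := map_sub (dirDerivHom X) f g

theorem dirDeriv_sum (X : Vect E M) {ι : Type*} (t : Finset ι) (f : ι → C^∞⟮𝓘(ℝ, E), M; ℝ⟯) :
    dirDeriv X (∑ i ∈ t, f i) = ∑ i ∈ t, dirDeriv X (f i) := map_sum (dirDerivHom X) f t

theorem dirDeriv_congr (X : Vect E M) {f g : C^∞⟮𝓘(ℝ, E), M; ℝ⟯} {x : M}
    (h : ∀ᶠ y in 𝓝 x, f y = g y) : dirDeriv X f x = dirDeriv X g x := by
  have : f =ᶠ[𝓝 x] g := h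
  change mvfderiv 𝓘(ℝ, E) f x (X x) = mvfderiv 𝓘(ℝ, E) g x (X x)
  rw [mvfderiv, mvfderiv, this.mfderiv_eq, this.eq_of_nhds]

variable [FiniteDimensional ℝ E] [T2Space M] [CompleteSpace E]

theorem dirDeriv_bracket (X Y : Vect E M) (f : C^∞⟮𝓘(ℝ, E), M; ℝ⟯) :
    dirDeriv ⁅X, Y⁆ f = dirDeriv X (dirDeriv Y f) - dirDeriv Y (dirDeriv X f) := by
  have key : ∀ Z : Vect E M, (dirDeriv ⁅X, Y⁆ f) • Z =
      (dirDeriv X (dirDeriv Y f) - dirDeriv Y (dirDeriv X f)) • Z := by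
    intro Z
    have h := leibniz_lie X Y (f • Z)
    have h2 := leibniz_lie X Y Z
    simp only [bracket_fsmul, lie_add] at h
    rw [h2] at h
    linear_combination (norm := module) -h
  ext x
  rcases subsingleton_or_nontrivial E with hE | hE
  · have : (⁅X, Y⁆ : Vect E M) x = 0 := Subsingleton.elim (α := E) _ _
    have h1 : X x = 0 := Subsingleton.elim (α := E) _ _
    have h2 : Y x = 0 := Subsingleton.elim (α := E) _ _
    change dirDeriv ⁅X, Y⁆ f x = dirDeriv X _ x - dirDeriv Y _ x
    rw [dirDeriv_apply, dirDeriv_apply, dirDeriv_apply, this, h1, h2]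
    simp
  · obtain ⟨v, hv⟩ : ∃ v : TangentSpace 𝓘(ℝ, E) x, v ≠ 0 := exists_ne (0 : E)
    have h := congrArg (fun s : Vect E M => s x) (key (extend x v))
    simp only [fsmul_apply, extend_self] at h
    exact smul_left_injective ℝ hv h

end Derivations
section LieDerivatives

variable {E : Type*} [NormedAddCommGroup E] [NormedSpace ℝ E] [FiniteDimensional ℝ E]
  {M : Type*} [TopologicalSpace M] [ChartedSpace E M] [IsManifold 𝓘(ℝ, E) ∞ M] [T2Space M]

namespace OneForm

theorem eval_apply (α : OneForm E M) (Y : Vect E M) (x : M) : α.eval Y x = α x (Y x) := rfl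

theorem eval_add (α : OneForm E M) (Y Z : Vect E M) : α.eval (Y + Z) = α.eval Y + α.eval Z := by
  ext x; exact map_add (α x) (Y x) (Z x)

theorem eval_fsmul (α : OneForm E M) (f : C^∞⟮𝓘(ℝ, E), M; ℝ⟯) (Y : Vect E M) :
    α.eval (f • Y) = f * α.eval Y := by
  ext x; exact map_smul (α x) (f x) (Y x)

theorem add_eval (α β : OneForm E M) (Y : Vect E M) : (α + β).eval Y = α.eval Y + β.eval Y := by
  ext x; rfl

theorem smul_eval (c : ℝ) (α : OneForm E M) (Y : Vect E M) : (c • α).eval Y = c • α.eval Y := by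
  ext x; rfl

theorem ext_eval {α β : OneForm E M} (h : ∀ Y, α.eval Y = β.eval Y) : α = β := by
  ext x : 1
  apply ContinuousLinearMap.ext
  intro v
  have := congrArg (fun f => f x) (h (extend x v))
  simpa only [eval_apply, extend_self] using! this

/-- A smooth function as a section of the trivial line bundle. -/
def funSection (f : C^∞⟮𝓘(ℝ, E), M; ℝ⟯) : Cₛ^∞⟮𝓘(ℝ, E); ℝ, Bundle.Trivial M ℝ⟯ :=
  ⟨f, contMDiff_trivial.2 f.contMDiff⟩

/-- The one-form given by a `C^∞(M)`-linear map. -/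
def mk (T : Vect E M → C^∞⟮𝓘(ℝ, E), M; ℝ⟯) (hadd : ∀ Y Z, T (Y + Z) = T Y + T Z)
    (hsmul : ∀ (f : C^∞⟮𝓘(ℝ, E), M; ℝ⟯) Y, T (f • Y) = f * T Y) : OneForm E M :=
  mkHom (fun Y => funSection (T Y)) (fun Y Z => by rw [hadd]; rfl) (fun f Y => by rw [hsmul]; rfl)

theorem mk_eval (T : Vect E M → C^∞⟮𝓘(ℝ, E), M; ℝ⟯) (hadd : ∀ Y Z, T (Y + Z) = T Y + T Z)
    (hsmul : ∀ (f : C^∞⟮𝓘(ℝ, E), M; ℝ⟯) Y, T (f • Y) = f * T Y) (Y : Vect E M) :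
    (mk T hadd hsmul).eval Y = T Y := by
  ext x
  exact mkHom_apply (fun Y => funSection (T Y)) _ _ Y x

variable [CompleteSpace E]

/-- The Lie derivative of one-forms, `(L_X α)(Y) = X(α(Y)) - α([X, Y])`. -/
instance instBracketOneForm : Bracket (Vect E M) (OneForm E M) :=
  ⟨fun X α => mk (fun Y => dirDeriv X (α.eval Y) - α.eval ⁅X, Y⁆)
    (fun Y Z => by rw [eval_add, dirDeriv_add, lie_add, eval_add]; ring)
    (fun f Y => by
      rw [eval_fsmul, dirDeriv_mul, bracket_fsmul, eval_add, eval_fsmul, eval_fsmul]; ring)⟩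

theorem lie_eval (X : Vect E M) (α : OneForm E M) (Y : Vect E M) :
    (⁅X, α⁆ : OneForm E M).eval Y = dirDeriv X (α.eval Y) - α.eval ⁅X, Y⁆ := mk_eval _ _ _ _

/-- The evaluation at a field as an additive map. -/
def evalHom (α : OneForm E M) : Vect E M →+ C^∞⟮𝓘(ℝ, E), M; ℝ⟯ :=
  AddMonoidHom.mk' α.eval (eval_add α)

theorem eval_sub (α : OneForm E M) (Y Z : Vect E M) : α.eval (Y - Z) = α.eval Y - α.eval Z :=
  map_sub α.evalHom Y Z

theorem dirDeriv_smul (c : ℝ) (X : Vect E M) (f : C^∞⟮𝓘(ℝ, E), M; ℝ⟯) :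
    dirDeriv X (c • f) = c • dirDeriv X f := by
  have h := dirDeriv_mul X (constFun c) f
  have h2 : dirDeriv X (constFun c : C^∞⟮𝓘(ℝ, E), M; ℝ⟯) = 0 := dirDeriv_const X c
  rw [h2, mul_zero, add_zero] at h
  exact h

instance instLieRingModuleOneForm : LieRingModule (Vect E M) (OneForm E M) where
  add_lie X Y α := ext_eval fun Z => by
    simp only [lie_eval, add_eval, add_dirDeriv, add_lie, eval_add]; ring
  lie_add X α β := ext_eval fun Z => by
    simp only [lie_eval, add_eval, dirDeriv_add]; ring
  leibniz_lie X Y α := ext_eval fun Z => by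
    simp only [lie_eval, add_eval, dirDeriv_sub, dirDeriv_bracket]
    rw [leibniz_lie X Y Z, eval_add]
    ring

instance instLieModuleOneForm : LieModule ℝ (Vect E M) (OneForm E M) where
  smul_lie c X α := ext_eval fun Z => by
    have h : c • X = (constFun c : C^∞⟮𝓘(ℝ, E), M; ℝ⟯) • X := rfl
    have h1 : ⁅c • X, Z⁆ = (constFun c : C^∞⟮𝓘(ℝ, E), M; ℝ⟯) • ⁅X, Z⁆ := smul_lie c X Z
    rw [smul_eval, lie_eval, lie_eval, h1, h, fsmul_dirDeriv, eval_fsmul, ← mul_sub]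
    rfl
  lie_smul c X α := ext_eval fun Z => by
    simp only [lie_eval, smul_eval, dirDeriv_smul, smul_sub]

end OneForm

namespace Tensor12

theorem eval_apply (S : Tensor12 E M) (Y Z : Vect E M) (x : M) :
    S.eval Y Z x = S x (Y x) (Z x) := rfl

theorem eval_add_left (S : Tensor12 E M) (Y Y' Z : Vect E M) :
    S.eval (Y + Y') Z = S.eval Y Z + S.eval Y' Z := by
  ext x; exact congrArg (fun l => l (Z x)) (map_add (S x) (Y x) (Y' x))

theorem eval_add_right (S : Tensor12 E M) (Y Z Z' : Vect E M) :
    S.eval Y (Z + Z') = S.eval Y Z + S.eval Y Z' := by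
  ext x; exact map_add (S x (Y x)) (Z x) (Z' x)

theorem eval_fsmul_left (S : Tensor12 E M) (f : C^∞⟮𝓘(ℝ, E), M; ℝ⟯) (Y Z : Vect E M) :
    S.eval (f • Y) Z = f • S.eval Y Z := by
  ext x; exact congrArg (fun l => l (Z x)) (map_smul (S x) (f x) (Y x))

theorem eval_fsmul_right (S : Tensor12 E M) (f : C^∞⟮𝓘(ℝ, E), M; ℝ⟯) (Y Z : Vect E M) :
    S.eval Y (f • Z) = f • S.eval Y Z := by
  ext x; exact map_smul (S x (Y x)) (f x) (Z x)

theorem add_eval (S T : Tensor12 E M) (Y Z : Vect E M) :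
    (S + T).eval Y Z = S.eval Y Z + T.eval Y Z := by
  ext x; rfl

theorem smul_eval (c : ℝ) (S : Tensor12 E M) (Y Z : Vect E M) :
    (c • S).eval Y Z = c • S.eval Y Z := by
  ext x; rfl

theorem ext_eval {S T : Tensor12 E M} (h : ∀ Y Z, S.eval Y Z = T.eval Y Z) : S = T := by
  ext x : 1
  apply ContinuousLinearMap.ext
  intro v
  apply ContinuousLinearMap.ext
  intro w
  have := congrArg (fun f : Vect E M => f x) (h (extend x v) (extend x w))
  simpa only [eval_apply, extend_self] using! this

/-- The tensor field given by a `C^∞(M)`-bilinear map. -/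
def mk (B : Vect E M → Vect E M → Vect E M)
    (add_left : ∀ Y Y' Z, B (Y + Y') Z = B Y Z + B Y' Z)
    (smul_left : ∀ (f : C^∞⟮𝓘(ℝ, E), M; ℝ⟯) Y Z, B (f • Y) Z = f • B Y Z)
    (add_right : ∀ Y Z Z', B Y (Z + Z') = B Y Z + B Y Z')
    (smul_right : ∀ (f : C^∞⟮𝓘(ℝ, E), M; ℝ⟯) Y Z, B Y (f • Z) = f • B Y Z) : Tensor12 E M :=
  mkHom (V := fun x : M => TangentSpace 𝓘(ℝ, E) x →L[ℝ] TangentSpace 𝓘(ℝ, E) x)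
    (fun Y => mkHom (B Y) (add_right Y) (fun f => smul_right f Y))
    (fun Y Y' => by
      ext x : 1
      apply ContinuousLinearMap.ext
      intro v
      rw [← extend_self x v]
      refine (mkHom_apply _ _ _ _ _).trans ?_
      rw [add_left]
      exact (congrArg₂ (· + ·) (mkHom_apply (B Y) _ _ _ _) (mkHom_apply (B Y') _ _ _ _)).symm)
    (fun f Y => by
      ext x : 1
      apply ContinuousLinearMap.ext
      intro v
      rw [← extend_self x v]
      refine (mkHom_apply _ _ _ _ _).trans ?_
      rw [smul_left]
      exact (congrArg (f x • ·) (mkHom_apply (B Y) _ _ _ _)).symm)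

theorem mk_eval (B : Vect E M → Vect E M → Vect E M)
    (add_left : ∀ Y Y' Z, B (Y + Y') Z = B Y Z + B Y' Z)
    (smul_left : ∀ (f : C^∞⟮𝓘(ℝ, E), M; ℝ⟯) Y Z, B (f • Y) Z = f • B Y Z)
    (add_right : ∀ Y Z Z', B Y (Z + Z') = B Y Z + B Y Z')
    (smul_right : ∀ (f : C^∞⟮𝓘(ℝ, E), M; ℝ⟯) Y Z, B Y (f • Z) = f • B Y Z) (Y Z : Vect E M) :
    (mk B add_left smul_left add_right smul_right).eval Y Z = B Y Z := by
  ext x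
  refine Eq.trans ?_ (mkHom_apply (B Y) (add_right Y) (fun f => smul_right f Y) Z x)
  exact congrArg (fun l => l (Z x)) (mkHom_apply (F := E →L[ℝ] E)
    (V := fun x : M => TangentSpace 𝓘(ℝ, E) x →L[ℝ] TangentSpace 𝓘(ℝ, E) x) _ _ _ Y x)

variable [CompleteSpace E]

/-- The Lie derivative of tensor fields of type `(1,2)`,
`(L_X S)(Y, Z) = [X, S(Y, Z)] - S([X, Y], Z) - S(Y, [X, Z])`. -/
instance instBracketTensor12 : Bracket (Vect E M) (Tensor12 E M) :=
  ⟨fun X S => mk (fun Y Z => ⁅X, S.eval Y Z⁆ - S.eval ⁅X, Y⁆ Z - S.eval Y ⁅X, Z⁆)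
    (fun Y Y' Z => by simp only [eval_add_left, lie_add]; abel)
    (fun f Y Z => by
      simp only [eval_fsmul_left, bracket_fsmul, eval_add_left]; module)
    (fun Y Z Z' => by simp only [eval_add_right, lie_add]; abel)
    (fun f Y Z => by
      simp only [eval_fsmul_right, bracket_fsmul, eval_add_right]; module)⟩

theorem lie_eval (X : Vect E M) (S : Tensor12 E M) (Y Z : Vect E M) :
    (⁅X, S⁆ : Tensor12 E M).eval Y Z =
      ⁅X, S.eval Y Z⁆ - S.eval ⁅X, Y⁆ Z - S.eval Y ⁅X, Z⁆ := mk_eval _ _ _ _ _ _ _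

instance instLieRingModuleTensor12 : LieRingModule (Vect E M) (Tensor12 E M) where
  add_lie X Y S := ext_eval fun Z W => by
    simp only [lie_eval, add_eval, add_lie, eval_add_left, eval_add_right]; abel
  lie_add X S T := ext_eval fun Z W => by
    simp only [lie_eval, add_eval, lie_add]; abel
  leibniz_lie X Y S := ext_eval fun Z W => by
    simp only [lie_eval, add_eval, lie_sub]
    rw [leibniz_lie X Y (S.eval Z W), leibniz_lie X Y Z, leibniz_lie X Y W, eval_add_left,
      eval_add_right]
    abel

instance instLieModuleTensor12 : LieModule ℝ (Vect E M) (Tensor12 E M) where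
  smul_lie c X S := ext_eval fun Z W => by
    have h : ∀ W : Vect E M, ⁅c • X, W⁆ = (constFun c : C^∞⟮𝓘(ℝ, E), M; ℝ⟯) • ⁅X, W⁆ :=
      fun W => smul_lie c X W
    simp only [smul_eval, lie_eval, h, eval_fsmul_left, eval_fsmul_right, ← smul_sub]
    rfl
  lie_smul c X S := ext_eval fun Z W => by
    simp only [lie_eval, smul_eval, lie_smul, smul_sub]

end Tensor12

end LieDerivatives
section Trace

variable {E : Type*} [NormedAddCommGroup E] [NormedSpace ℝ E] [FiniteDimensional ℝ E]
  {M : Type*} [TopologicalSpace M] [ChartedSpace E M] [IsManifold 𝓘(ℝ, E) ∞ M] [T2Space M]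

instance instFiniteDimensionalTangentSpace (x : M) :
    FiniteDimensional ℝ (TangentSpace 𝓘(ℝ, E) x) := inferInstanceAs (FiniteDimensional ℝ E)

instance instT2TangentSpace (x : M) : T2Space (TangentSpace 𝓘(ℝ, E) x) :=
  inferInstanceAs (T2Space E)

/-- Local frames and coframes, cut off by a function `ψ`. -/
theorem exists_coframe (x : M) : ∃ (ψ : C^∞⟮𝓘(ℝ, E), M; ℝ⟯)
    (e : Fin (Module.finrank ℝ E) → Vect E M) (θ : Fin (Module.finrank ℝ E) → OneForm E M),
    (∀ᶠ y in 𝓝 x, ψ y = 1) ∧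
    ∀ (y : M) (v : TangentSpace 𝓘(ℝ, E) y), ψ y • v = ∑ i, (θ i y v : ℝ) • e i y := by
  obtain ⟨ψ, e, θ, t, h1, h2, h3⟩ := exists_frame (E := E) x
  refine ⟨ψ, e, fun i => ⟨fun y => LinearMap.toContinuousLinearMap (t i y), contMDiff_hom
    (V := Bundle.Trivial M ℝ) _ (fun Y => OneForm.funSection (θ i Y)) fun y Y => (h2 i Y y).symm⟩,
    h1, fun y v => h3 y v⟩

theorem mul_trace {y : M} {c : ℝ} {ι : Type*} [Fintype ι] {e : ι → TangentSpace 𝓘(ℝ, E) y}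
    {θ : ι → (TangentSpace 𝓘(ℝ, E) y →ₗ[ℝ] ℝ)}
    (h : ∀ v, c • v = ∑ i, θ i v • e i)
    (A : TangentSpace 𝓘(ℝ, E) y →ₗ[ℝ] TangentSpace 𝓘(ℝ, E) y) :
    c * LinearMap.trace ℝ _ A = ∑ i, θ i (A (e i)) := by
  have h1 : c • A = ∑ i, (θ i).smulRight (A (e i)) := by
    ext v
    rw [LinearMap.smul_apply, ← map_smul, h, map_sum, LinearMap.sum_apply]
    simp only [map_smul, LinearMap.smulRight_apply]
  have h2 := congrArg (LinearMap.trace ℝ _) h1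
  rw [map_smul, map_sum] at h2
  simpa only [LinearMap.trace_smulRight, smul_eq_mul] using h2

namespace Tensor12

/-- The endomorphism `w ↦ S(w, v)` of a tangent space. -/
def slot (S : Tensor12 E M) (x : M) (v : TangentSpace 𝓘(ℝ, E) x) :
    TangentSpace 𝓘(ℝ, E) x →ₗ[ℝ] TangentSpace 𝓘(ℝ, E) x where
  toFun w := S x w v
  map_add' w w' := congrArg (fun l => l v) (map_add (S x) w w')
  map_smul' c w := congrArg (fun l => l v) (map_smul (S x) c w)

theorem slot_apply (S : Tensor12 E M) (x : M) (v w : TangentSpace 𝓘(ℝ, E) x) :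
    S.slot x v w = S x w v := rfl

/-- The linear form `v ↦ trace (w ↦ S(w, v))` on a tangent space. -/
def traceAt (S : Tensor12 E M) (x : M) : TangentSpace 𝓘(ℝ, E) x →ₗ[ℝ] ℝ where
  toFun v := LinearMap.trace ℝ (TangentSpace 𝓘(ℝ, E) x) (S.slot x v)
  map_add' v v' := by
    rw [← map_add]
    congr 1
    ext w
    exact map_add (S x w) v v'
  map_smul' c v := by
    rw [RingHom.id_apply, ← map_smul]
    congr 1
    ext w
    exact map_smul (S x w) c v

/-- The smooth function `x ↦ trace (w ↦ S(w, Y))`. -/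
def traceFun (S : Tensor12 E M) (Y : Vect E M) : C^∞⟮𝓘(ℝ, E), M; ℝ⟯ :=
  ⟨fun x => S.traceAt x (Y x), by
    intro x
    obtain ⟨ψ, e, θ, h1, h2⟩ := exists_coframe (E := E) x
    refine (∑ i, (θ i).eval (S.eval (e i) Y)).contMDiff.contMDiffAt.congr_of_eventuallyEq ?_
    filter_upwards [h1] with y hy
    have h := mul_trace (θ := fun i => (θ i y : TangentSpace 𝓘(ℝ, E) y →ₗ[ℝ] ℝ)) (h2 y)
      (S.slot y (Y y))
    rw [hy, one_mul] at h
    refine h.trans ?_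
    rw [fun_sum_apply]
    rfl⟩

/-- The trace `tr(S)` of a tensor field of type `(1,2)`, `tr(S)(v) = trace (w ↦ S(w, v))`. -/
def tr (S : Tensor12 E M) : OneForm E M :=
  ⟨fun x => LinearMap.toContinuousLinearMap (S.traceAt x), contMDiff_hom (V := Bundle.Trivial M ℝ)
    _ (fun Y => OneForm.funSection (S.traceFun Y)) fun _ _ => rfl⟩

theorem tr_apply (S : Tensor12 E M) (x : M) (v : TangentSpace 𝓘(ℝ, E) x) :
    S.tr x v = LinearMap.trace ℝ (TangentSpace 𝓘(ℝ, E) x) (S.slot x v) := rfl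

theorem tr_add (S T : Tensor12 E M) : (S + T).tr = S.tr + T.tr := by
  ext x : 1
  apply ContinuousLinearMap.ext
  intro v
  exact map_add (LinearMap.trace ℝ (TangentSpace 𝓘(ℝ, E) x)) (S.slot x v) (T.slot x v)

theorem tr_smul (c : ℝ) (S : Tensor12 E M) : (c • S).tr = c • S.tr := by
  ext x : 1
  apply ContinuousLinearMap.ext
  intro v
  exact map_smul (LinearMap.trace ℝ (TangentSpace 𝓘(ℝ, E) x)) c (S.slot x v)

variable [CompleteSpace E]

theorem tr_lie (X : Vect E M) (S : Tensor12 E M) :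
    (⁅X, S⁆ : Tensor12 E M).tr = ⁅X, S.tr⁆ := by
  apply OneForm.ext_eval
  intro Y
  ext x
  obtain ⟨ψ, e, θ, h1, h2⟩ := exists_coframe (E := E) x
  have htr : ∀ (T : Tensor12 E M) (Z : Vect E M),
      ψ * T.tr.eval Z = ∑ i, (θ i).eval (T.eval (e i) Z) := by
    intro T Z
    ext y
    rw [fun_sum_apply]
    exact mul_trace (θ := fun i => (θ i y : TangentSpace 𝓘(ℝ, E) y →ₗ[ℝ] ℝ)) (h2 y)
      (T.slot y (Z y))
  have htr1 : ∀ (T : Tensor12 E M) (Z : Vect E M) , ∀ᶠ y in 𝓝 x,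
      T.tr.eval Z y = (∑ i, (θ i).eval (T.eval (e i) Z)) y := by
    intro T Z
    filter_upwards [h1] with y hy
    rw [← htr]
    exact (one_mul _).symm.trans (congrArg (· * T.tr.eval Z y) hy.symm)
  have hψ : dirDeriv X ψ x = 0 := by
    rw [dirDeriv_congr X (g := ⟨fun _ => 1, contMDiff_const⟩) h1, dirDeriv_const]
    rfl
  have hdec : ∀ W : Vect E M, ψ • W = ∑ i, (θ i).eval W • e i := by
    intro W
    ext y
    rw [section_sum_apply]
    exact h2 y (W y)
  have hzero : ∀ W : Vect E M,
      (∑ i, ((⁅X, θ i⁆ : OneForm E M).eval W • e i + (θ i).eval W • ⁅X, e i⁆)) x = 0 := by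
    intro W
    have h3 : ∑ i, ((⁅X, θ i⁆ : OneForm E M).eval W • e i + (θ i).eval W • ⁅X, e i⁆) =
        dirDeriv X ψ • W := by
      have h4 := congrArg (fun s => ⁅X, s⁆) (hdec W)
      have h5 := hdec ⁅X, W⁆
      simp only [bracket_fsmul, lie_sum] at h4
      rw [h5] at h4
      rw [← add_right_cancel_iff (a := ∑ i, (θ i).eval ⁅X, W⁆ • e i), h4, ← Finset.sum_add_distrib]
      refine Finset.sum_congr rfl fun i _ => ?_
      rw [OneForm.lie_eval]
      module
    rw [h3]
    change dirDeriv X ψ x • W x = 0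
    rw [hψ, zero_smul]
  have hsum : ∑ i, ((⁅X, θ i⁆ : OneForm E M).eval (S.eval (e i) Y) x +
      (θ i).eval (S.eval ⁅X, e i⁆ Y) x) = 0 := by
    have hB : ∑ i, (LinearMap.smulRight (⁅X, θ i⁆ x : TangentSpace 𝓘(ℝ, E) x →ₗ[ℝ] ℝ)
          (S.eval (e i) Y x) +
        LinearMap.smulRight (θ i x : TangentSpace 𝓘(ℝ, E) x →ₗ[ℝ] ℝ) (S.eval ⁅X, e i⁆ Y x)) = 0 := by
      ext v
      have h3 := congrArg (S.slot x (Y x)) (hzero (extend x v))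
      rw [section_sum_apply, map_sum, map_zero] at h3
      rw [LinearMap.sum_apply]
      refine Eq.trans (Finset.sum_congr rfl fun i _ => ?_) h3
      refine Eq.trans ?_ (map_add (S.slot x (Y x)) _ _).symm
      rw [LinearMap.add_apply]
      congr 1
      · refine Eq.trans ?_ (map_smul (S.slot x (Y x)) _ _).symm
        rw [OneForm.eval_apply, extend_self]
        rfl
      · refine Eq.trans ?_ (map_smul (S.slot x (Y x)) _ _).symm
        rw [OneForm.eval_apply, extend_self]
        rfl
    have h4 := congrArg (LinearMap.trace ℝ _) hB
    simp only [map_sum, map_add, map_zero, LinearMap.trace_smulRight] at h4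
    exact h4
  rw [(htr1 _ _).self_of_nhds, OneForm.lie_eval]
  change _ = dirDeriv X (S.tr.eval Y) x - S.tr.eval ⁅X, Y⁆ x
  rw [dirDeriv_congr X (htr1 S Y), (htr1 S ⁅X, Y⁆).self_of_nhds, dirDeriv_sum, fun_sum_apply,
    fun_sum_apply, fun_sum_apply, ← Finset.sum_sub_distrib, ← sub_eq_zero,
    ← Finset.sum_sub_distrib, ← neg_eq_zero, ← Finset.sum_neg_distrib, ← hsum]
  refine Finset.sum_congr rfl fun i _ => ?_
  simp only [lie_eval, OneForm.lie_eval, OneForm.eval_sub]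
  change -((θ i).eval _ x - (θ i).eval _ x - (θ i).eval _ x -
    (dirDeriv X _ x - (θ i).eval _ x)) = (dirDeriv X _ x - (θ i).eval _ x) + (θ i).eval _ x
  ring

end Tensor12

namespace OneForm

/-- The bilinear map `(u, v) ↦ α(u) v + α(v) u` on a tangent space. -/
def tensorIdAt (α : OneForm E M) (x : M) : TangentSpace 𝓘(ℝ, E) x →ₗ[ℝ]
    (TangentSpace 𝓘(ℝ, E) x →L[ℝ] TangentSpace 𝓘(ℝ, E) x) where
  toFun u := LinearMap.toContinuousLinearMap
    { toFun := fun v => (α x u : ℝ) • v + (α x v : ℝ) • u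
      map_add' := fun v v' => by
        have h : (α x (v + v') : ℝ) = α x v + α x v' := map_add (α x) v v'
        rw [h]; module
      map_smul' := fun c v => by
        have h : (α x (c • v) : ℝ) = c * α x v := map_smul (α x) c v
        rw [h, RingHom.id_apply]; module }
  map_add' u u' := by
    apply ContinuousLinearMap.ext
    intro v
    have h : (α x (u + u') : ℝ) = α x u + α x u' := map_add (α x) u u'
    change (α x (u + u') : ℝ) • v + (α x v : ℝ) • (u + u') =
      ((α x u : ℝ) • v + (α x v : ℝ) • u) + ((α x u' : ℝ) • v + (α x v : ℝ) • u')
    rw [h]; module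
  map_smul' c u := by
    apply ContinuousLinearMap.ext
    intro v
    have h : (α x (c • u) : ℝ) = c * α x u := map_smul (α x) c u
    change (α x (c • u) : ℝ) • v + (α x v : ℝ) • (c • u) =
      c • ((α x u : ℝ) • v + (α x v : ℝ) • u)
    rw [h]; module

/-- The tensor field `α𝟙`, `(α𝟙)(u, v) = α(u) v + α(v) u`. -/
def tensorId (α : OneForm E M) : Tensor12 E M :=
  ⟨fun x => LinearMap.toContinuousLinearMap (α.tensorIdAt x), contMDiff_hom (F := E →L[ℝ] E)
    (V := fun x : M => TangentSpace 𝓘(ℝ, E) x →L[ℝ] TangentSpace 𝓘(ℝ, E) x) _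
    (fun Y => ⟨fun x => α.tensorIdAt x (Y x), contMDiff_hom _
      (fun Z => α.eval Y • Z + α.eval Z • Y) fun _ _ => rfl⟩) fun _ _ => rfl⟩

theorem tensorId_apply (α : OneForm E M) (x : M) (u v : TangentSpace 𝓘(ℝ, E) x) :
    α.tensorId x u v = (α x u : ℝ) • v + (α x v : ℝ) • u := rfl

theorem tensorId_eval (α : OneForm E M) (Y Z : Vect E M) :
    α.tensorId.eval Y Z = α.eval Y • Z + α.eval Z • Y := rfl

theorem tensorId_add (α β : OneForm E M) : (α + β).tensorId = α.tensorId + β.tensorId :=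
  Tensor12.ext_eval fun Y Z => by
    rw [Tensor12.add_eval, tensorId_eval, tensorId_eval, tensorId_eval, add_eval, add_eval]
    module

theorem tensorId_smul (c : ℝ) (α : OneForm E M) : (c • α).tensorId = c • α.tensorId := by
  ext x : 1
  apply ContinuousLinearMap.ext
  intro u
  apply ContinuousLinearMap.ext
  intro v
  change (c * α x u : ℝ) • v + (c * α x v : ℝ) • u = c • ((α x u : ℝ) • v + (α x v : ℝ) • u)
  module

theorem tr_tensorId (α : OneForm E M) :
    α.tensorId.tr = ((Module.finrank ℝ E : ℝ) + 1) • α := by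
  ext x : 1
  apply ContinuousLinearMap.ext
  intro v
  have h : α.tensorId.slot x v =
      LinearMap.smulRight (α x : TangentSpace 𝓘(ℝ, E) x →ₗ[ℝ] ℝ) v + (α x v : ℝ) • LinearMap.id := by
    ext w
    rfl
  rw [Tensor12.tr_apply, h, map_add, map_smul, LinearMap.trace_smulRight, LinearMap.trace_id]
  change (α x v : ℝ) + (α x v : ℝ) * (Module.finrank ℝ E : ℝ) = ((Module.finrank ℝ E : ℝ) + 1) * α x v
  ring

variable [CompleteSpace E]

theorem tensorId_lie (X : Vect E M) (α : OneForm E M) :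
    (⁅X, α⁆ : OneForm E M).tensorId = ⁅X, α.tensorId⁆ :=
  Tensor12.ext_eval fun Y Z => by
    rw [Tensor12.lie_eval, tensorId_eval, tensorId_eval, tensorId_eval, tensorId_eval, lie_eval,
      lie_eval, lie_add, bracket_fsmul, bracket_fsmul]
    module

end OneForm

end Trace
section SymmetricTensors

variable (E : Type*) [NormedAddCommGroup E] [NormedSpace ℝ E] [FiniteDimensional ℝ E]
  [CompleteSpace E]
  (M : Type*) [TopologicalSpace M] [ChartedSpace E M] [IsManifold 𝓘(ℝ, E) ∞ M] [T2Space M]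

instance instAddCommGroupOneForm : AddCommGroup (OneForm E M) := ContMDiffSection.instAddCommGroup

instance instModuleOneForm : Module ℝ (OneForm E M) := ContMDiffSection.instModule

variable {E M} in
theorem symm_iff (S : Tensor12 E M) :
    (∀ x u v, S x u v = S x v u) ↔ ∀ Y Z, S.eval Y Z = S.eval Z Y := by
  constructor
  · intro h Y Z
    ext x
    exact h x _ _
  · intro h x u v
    have := congrArg (fun f : Vect E M => f x) (h (extend x u) (extend x v))
    simpa only [Tensor12.eval_apply, extend_self] using! this

/-- The space of smooth symmetric tensor fields of type `(1,2)` on `M`, i.e. of smooth sections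
of `∨² T*M ⊗ TM`, with the Lie derivative. -/
def SymTensor : LieSubmodule ℝ (Vect E M) (Tensor12 E M) where
  carrier := {S | ∀ x u v, S x u v = S x v u}
  add_mem' := by
    intro S T hS hT x u v
    change S x u v + T x u v = S x v u + T x v u
    rw [hS x u v, hT x u v]
  zero_mem' := by intro x u v; rfl
  smul_mem' := by
    intro c S hS x u v
    change c • S x u v = c • S x v u
    rw [hS x u v]
  lie_mem := by
    intro X S hS
    refine (symm_iff _).2 fun Y Z => ?_
    have h := (symm_iff _).1 hS
    rw [Tensor12.lie_eval, Tensor12.lie_eval, h Y Z, h ⁅X, Y⁆ Z, h Y ⁅X, Z⁆]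
    abel

instance instAddCommGroupSymTensor : AddCommGroup (SymTensor E M) :=
  AddSubgroupClass.toAddCommGroup (SymTensor E M)

instance instModuleSymTensor : Module ℝ (SymTensor E M) :=
  SMulMemClass.toModule (SymTensor E M)

instance instLieRingModuleSymTensor : LieRingModule (Vect E M) (SymTensor E M) :=
  LieSubmodule.instLieRingModuleSubtypeMem (SymTensor E M)

instance instLieModuleSymTensor : LieModule ℝ (Vect E M) (SymTensor E M) :=
  LieSubmodule.instLieModule (SymTensor E M)

/-- The trace of symmetric tensor fields, as an equivariant linear map. -/
def trHom : SymTensor E M →ₗ⁅ℝ, Vect E M⁆ OneForm E M where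
  toFun S := S.1.tr
  map_add' S T := Tensor12.tr_add S.1 T.1
  map_smul' c S := Tensor12.tr_smul c S.1
  map_lie' := fun {X S} => Tensor12.tr_lie X S.1

/-- The map `α ↦ α𝟙`, as an equivariant linear map. -/
def idHom : OneForm E M →ₗ⁅ℝ, Vect E M⁆ SymTensor E M where
  toFun α := ⟨α.tensorId, (symm_iff _).2 fun Y Z => by
    rw [OneForm.tensorId_eval, OneForm.tensorId_eval, add_comm]⟩
  map_add' α β := Subtype.ext (OneForm.tensorId_add α β)
  map_smul' c α := Subtype.ext (OneForm.tensorId_smul c α)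
  map_lie' := fun {X α} => Subtype.ext (OneForm.tensorId_lie X α)

/-- The space of trace-free symmetric tensor fields of type `(1,2)`. -/
def TraceFree : LieSubmodule ℝ (Vect E M) (SymTensor E M) := (trHom E M).ker

instance instAddCommGroupTraceFree : AddCommGroup (TraceFree E M) :=
  AddSubgroupClass.toAddCommGroup (TraceFree E M)

instance instModuleTraceFree : Module ℝ (TraceFree E M) :=
  SMulMemClass.toModule (TraceFree E M)

instance instLieRingModuleTraceFree : LieRingModule (Vect E M) (TraceFree E M) :=
  LieSubmodule.instLieRingModuleSubtypeMem (TraceFree E M)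

instance instLieModuleTraceFree : LieModule ℝ (Vect E M) (TraceFree E M) :=
  LieSubmodule.instLieModule (TraceFree E M)

variable {E M}

theorem mem_traceFree {S : SymTensor E M} : S ∈ TraceFree E M ↔ S.1.tr = 0 :=
  LieModuleHom.mem_ker

theorem trHom_idHom (α : OneForm E M) :
    trHom E M (idHom E M α) = ((Module.finrank ℝ E : ℝ) + 1) • α := OneForm.tr_tensorId α

variable (E M) in
/-- The projection `S ↦ S - (1 / (m + 1)) tr(S)𝟙`, where `m` is the dimension, with values in the
space of all symmetric tensor fields. -/
def prSym : SymTensor E M →ₗ⁅ℝ, Vect E M⁆ SymTensor E M :=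
  LieModuleHom.id - (1 / ((Module.finrank ℝ E : ℝ) + 1)) • (idHom E M).comp (trHom E M)

theorem prSym_apply (S : SymTensor E M) :
    prSym E M S = S - (1 / ((Module.finrank ℝ E : ℝ) + 1)) • idHom E M (trHom E M S) := rfl

theorem trHom_prSym (S : SymTensor E M) : trHom E M (prSym E M S) = 0 := by
  have h : (Module.finrank ℝ E : ℝ) + 1 ≠ 0 := by positivity
  have h1 := map_sub (trHom E M : SymTensor E M →ₗ[ℝ] OneForm E M) S
    ((1 / ((Module.finrank ℝ E : ℝ) + 1)) • idHom E M (trHom E M S))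
  have h2 := map_smul (trHom E M : SymTensor E M →ₗ[ℝ] OneForm E M)
    (1 / ((Module.finrank ℝ E : ℝ) + 1)) (idHom E M (trHom E M S))
  refine h1.trans ?_
  rw [h2]
  change trHom E M S - _ • trHom E M (idHom E M (trHom E M S)) = 0
  rw [trHom_idHom, smul_smul, one_div_mul_cancel h, one_smul, sub_self]

variable (E M) in
/-- The projection `pr(S) = S - (1 / (m + 1)) tr(S)𝟙` onto the trace-free tensor fields, where
`m` is the dimension. -/
def pr : SymTensor E M →ₗ⁅ℝ, Vect E M⁆ TraceFree E M where
  toFun S := ⟨prSym E M S, LieModuleHom.mem_ker.2 (trHom_prSym S)⟩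
  map_add' S T := Subtype.ext (map_add (prSym E M : SymTensor E M →ₗ[ℝ] SymTensor E M) S T)
  map_smul' c S := Subtype.ext (map_smul (prSym E M : SymTensor E M →ₗ[ℝ] SymTensor E M) c S)
  map_lie' := fun {X S} => Subtype.ext (LieModuleHom.map_lie (prSym E M) X S)

theorem pr_coe (S : SymTensor E M) :
    (pr E M S : SymTensor E M) =
      S - (1 / ((Module.finrank ℝ E : ℝ) + 1)) • idHom E M (trHom E M S) := rfl

theorem idHom_smul (c : ℝ) (α : OneForm E M) : idHom E M (c • α) = c • idHom E M α :=
  map_smul (idHom E M : OneForm E M →ₗ[ℝ] SymTensor E M) c α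

theorem pr_eq_zero_iff (S : SymTensor E M) : pr E M S = 0 ↔ ∃ α, S = idHom E M α := by
  constructor
  · intro h
    refine ⟨(1 / ((Module.finrank ℝ E : ℝ) + 1)) • trHom E M S, ?_⟩
    rw [idHom_smul, ← sub_eq_zero, ← pr_coe, h]
    rfl
  · rintro ⟨α, rfl⟩
    have h : (Module.finrank ℝ E : ℝ) + 1 ≠ 0 := by positivity
    apply Subtype.ext
    rw [pr_coe, trHom_idHom, idHom_smul, smul_smul, one_div_mul_cancel h, one_smul, sub_self]
    rfl

theorem pr_idHom (α : OneForm E M) : pr E M (idHom E M α) = 0 := (pr_eq_zero_iff _).2 ⟨α, rfl⟩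

theorem pr_traceFree (S : TraceFree E M) : pr E M (S : SymTensor E M) = S := by
  apply Subtype.ext
  have h0 : idHom E M 0 = 0 := map_zero (idHom E M : OneForm E M →ₗ[ℝ] SymTensor E M)
  rw [pr_coe, LieModuleHom.mem_ker.1 S.2, h0, smul_zero, sub_zero]

end SymmetricTensors

section Connections

variable (E : Type*) [NormedAddCommGroup E] [NormedSpace ℝ E] [FiniteDimensional ℝ E]
  [CompleteSpace E]
  (M : Type*) [TopologicalSpace M] [ChartedSpace E M] [IsManifold 𝓘(ℝ, E) ∞ M] [T2Space M]

/-- Torsion-free linear connections on `M`, given by their covariant derivatives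
`(Y, Z) ↦ ∇_Y Z` of smooth vector fields. -/
@[ext] structure TorsionFreeConnection where
  nabla : Vect E M → Vect E M → Vect E M
  add_left : ∀ Y Y' Z, nabla (Y + Y') Z = nabla Y Z + nabla Y' Z
  fsmul_left : ∀ (f : C^∞⟮𝓘(ℝ, E), M; ℝ⟯) Y Z, nabla (f • Y) Z = f • nabla Y Z
  add_right : ∀ Y Z Z', nabla Y (Z + Z') = nabla Y Z + nabla Y Z'
  leibniz : ∀ Y (f : C^∞⟮𝓘(ℝ, E), M; ℝ⟯) Z, nabla Y (f • Z) = dirDeriv Y f • Z + f • nabla Y Z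
  torsion_free : ∀ Y Z, nabla Y Z - nabla Z Y = ⁅Y, Z⁆

variable {E M}

namespace TorsionFreeConnection

theorem symm (D : TorsionFreeConnection E M) (Y Z : Vect E M) :
    D.nabla Y Z = D.nabla Z Y + ⁅Y, Z⁆ := by
  rw [← D.torsion_free]; abel

theorem sub_left (D : TorsionFreeConnection E M) (Y Y' Z : Vect E M) :
    D.nabla (Y - Y') Z = D.nabla Y Z - D.nabla Y' Z :=
  map_sub (AddMonoidHom.mk' (fun Y => D.nabla Y Z) fun Y Y' => D.add_left Y Y' Z) Y Y'

theorem sub_right (D : TorsionFreeConnection E M) (Y Z Z' : Vect E M) :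
    D.nabla Y (Z - Z') = D.nabla Y Z - D.nabla Y Z' :=
  map_sub (AddMonoidHom.mk' (D.nabla Y) (D.add_right Y)) Z Z'

/-- A connection up to a factor: the local model that is glued below. -/
theorem exists_local (x : M) : ∃ (ψ : C^∞⟮𝓘(ℝ, E), M; ℝ⟯) (B : Vect E M → Vect E M → Vect E M),
    (∀ᶠ y in 𝓝 x, ψ y = 1) ∧
    (∀ Y Y' Z, B (Y + Y') Z = B Y Z + B Y' Z) ∧
    (∀ (f : C^∞⟮𝓘(ℝ, E), M; ℝ⟯) Y Z, B (f • Y) Z = f • B Y Z) ∧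
    (∀ Y Z Z', B Y (Z + Z') = B Y Z + B Y Z') ∧
    (∀ Y (f : C^∞⟮𝓘(ℝ, E), M; ℝ⟯) Z, B Y (f • Z) = (ψ * dirDeriv Y f) • Z + f • B Y Z) := by
  obtain ⟨ψ, e, θ, h1, h2⟩ := exists_coframe (E := E) x
  refine ⟨ψ, fun Y Z => ∑ i, dirDeriv Y ((θ i).eval Z) • e i, h1, ?_, ?_, ?_, ?_⟩
  · intro Y Y' Z
    simp only [add_dirDeriv, add_smul, Finset.sum_add_distrib]
  · intro f Y Z
    simp only [fsmul_dirDeriv, mul_smul, Finset.smul_sum]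
  · intro Y Z Z'
    simp only [OneForm.eval_add, dirDeriv_add, add_smul, Finset.sum_add_distrib]
  · intro Y f Z
    have h : ψ • Z = ∑ i, (θ i).eval Z • e i := by
      ext y
      rw [section_sum_apply]
      exact h2 y (Z y)
    rw [mul_comm, mul_smul, h]
    simp only [OneForm.eval_fsmul, dirDeriv_mul, add_smul, Finset.sum_add_distrib, Finset.smul_sum,
      mul_smul]
    rw [add_comm]
    congr 1
    refine Finset.sum_congr rfl fun i _ => ?_
    rw [smul_comm]

variable [SecondCountableTopology M]

theorem exists_connection : ∃ B : Vect E M → Vect E M → Vect E M,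
    (∀ Y Y' Z, B (Y + Y') Z = B Y Z + B Y' Z) ∧
    (∀ (f : C^∞⟮𝓘(ℝ, E), M; ℝ⟯) Y Z, B (f • Y) Z = f • B Y Z) ∧
    (∀ Y Z Z', B Y (Z + Z') = B Y Z + B Y Z') ∧
    (∀ Y (f : C^∞⟮𝓘(ℝ, E), M; ℝ⟯) Z, B Y (f • Z) = dirDeriv Y f • Z + f • B Y Z) := by
  choose ψ B h1 h2 h3 h4 h5 using exists_local (E := E) (M := M)
  have : LocallyCompactSpace M := Manifold.locallyCompact_of_finiteDimensional 𝓘(ℝ, E)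
  obtain ⟨ρ, hρ⟩ := SmoothPartitionOfUnity.exists_isSubordinate 𝓘(ℝ, E) (isClosed_univ (X := M))
    (fun x => interior {y | ψ x y = 1}) (fun x => isOpen_interior)
    (fun x _ => Set.mem_iUnion.2 ⟨x, mem_interior_iff_mem_nhds.2 (h1 x)⟩)
  have hψ : ∀ i y, ρ i y * ψ i y = ρ i y := by
    intro i y
    by_cases hy : y ∈ tsupport (ρ i)
    · have : y ∈ {y | ψ i y = 1} := interior_subset (hρ i hy)
      have : ψ i y = 1 := this
      rw [this, mul_one]
    · rw [image_eq_zero_of_notMem_tsupport hy, zero_mul]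
  let C : Vect E M → Vect E M → Vect E M := fun Y Z =>
    ⟨fun y => ∑ᶠ i, ρ i y • B i Y Z y, ContMDiff.finsum_section_of_locallyFinite
      (ρ.locallyFinite.subset fun i y hy => fun h => hy (by
        rw [h, zero_smul])) fun i =>
      ((ρ i).contMDiff.smul_section (B i Y Z).contMDiff)⟩
  have hC : ∀ Y Z y, C Y Z y = ∑ i ∈ ρ.finsupport y, ρ i y • B i Y Z y := fun Y Z y =>
    (ρ.sum_finsupport_smul_eq_finsum (A := TangentSpace 𝓘(ℝ, E) y) y
      (fun i _ => B i Y Z y)).symm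
  refine ⟨C, ?_, ?_, ?_, ?_⟩
  · intro Y Y' Z
    ext y
    change C (Y + Y') Z y = C Y Z y + C Y' Z y
    simp only [hC, ← Finset.sum_add_distrib, h2]
    exact Finset.sum_congr rfl fun i _ => smul_add _ _ _
  · intro f Y Z
    ext y
    change C (f • Y) Z y = f y • C Y Z y
    simp only [hC, Finset.smul_sum, h3]
    exact Finset.sum_congr rfl fun i _ => smul_comm (ρ i y) (f y) (B i Y Z y)
  · intro Y Z Z'
    ext y
    change C Y (Z + Z') y = C Y Z y + C Y Z' y
    simp only [hC, ← Finset.sum_add_distrib, h4]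
    exact Finset.sum_congr rfl fun i _ => smul_add _ _ _
  · intro Y f Z
    ext y
    change C Y (f • Z) y = dirDeriv Y f y • Z y + f y • C Y Z y
    have h6 : dirDeriv Y f y • Z y = ∑ i ∈ ρ.finsupport y, (ρ i y * dirDeriv Y f y) • Z y := by
      rw [← Finset.sum_smul, ← Finset.sum_mul, ρ.sum_finsupport y (Set.mem_univ y), one_mul]
    rw [h6]
    simp only [hC, Finset.smul_sum, ← Finset.sum_add_distrib, h5]
    refine Finset.sum_congr rfl fun i _ => ?_
    change ρ i y • ((ψ i y * dirDeriv Y f y) • Z y + f y • B i Y Z y) = _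
    rw [smul_add, smul_smul, ← mul_assoc, hψ, smul_comm]

instance instNonempty : Nonempty (TorsionFreeConnection E M) := by
  obtain ⟨B, h1, h2, h3, h4⟩ := exists_connection (E := E) (M := M)
  have hh : ∀ Y Z : Vect E M, (1 / 2 : ℝ) • (Y + Z) = (1 / 2 : ℝ) • Y + (1 / 2 : ℝ) • Z :=
    fun Y Z => smul_add _ _ _
  have hf : ∀ (f : C^∞⟮𝓘(ℝ, E), M; ℝ⟯) (Y : Vect E M), (1 / 2 : ℝ) • f • Y =
      f • (1 / 2 : ℝ) • Y := by
    intro f Y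
    ext y
    exact smul_comm (1 / 2 : ℝ) (f y) (Y y)
  refine ⟨⟨fun Y Z => (1 / 2 : ℝ) • (B Y Z + B Z Y + ⁅Y, Z⁆), ?_, ?_, ?_, ?_, ?_⟩⟩
  · intro Y Y' Z
    rw [← hh]
    congr 1
    rw [h1, h3, add_lie]
    abel
  · intro f Y Z
    rw [← hf]
    congr 1
    rw [h2, h4, fsmul_bracket]
    module
  · intro Y Z Z'
    rw [← hh]
    congr 1
    rw [h1, h3, lie_add]
    abel
  · intro Y f Z
    have h5 : dirDeriv Y f • Z = (1 / 2 : ℝ) • (dirDeriv Y f • Z + dirDeriv Y f • Z) := by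
      rw [← two_smul ℝ, smul_smul]
      norm_num
    rw [← hf, h5, ← hh]
    congr 1
    rw [h2, h4, bracket_fsmul]
    module
  · intro Y Z
    rw [← smul_sub, ← lie_skew Y Z]
    have h5 : B Y Z + B Z Y + -⁅Z, Y⁆ - (B Z Y + B Y Z + ⁅Z, Y⁆) = (2 : ℝ) • (-⁅Z, Y⁆) := by
      rw [two_smul]; abel
    rw [h5, smul_smul]
    norm_num

/-- The difference of two connections. -/
def diff (D D' : TorsionFreeConnection E M) : SymTensor E M :=
  ⟨Tensor12.mk (fun Y Z => D.nabla Y Z - D'.nabla Y Z)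
    (fun Y Y' Z => by rw [D.add_left, D'.add_left]; abel)
    (fun f Y Z => by rw [D.fsmul_left, D'.fsmul_left, smul_sub])
    (fun Y Z Z' => by rw [D.add_right, D'.add_right]; abel)
    (fun f Y Z => by rw [D.leibniz, D'.leibniz, smul_sub]; abel), (symm_iff _).2 fun Y Z => by
      rw [Tensor12.mk_eval, Tensor12.mk_eval, D.symm Y Z, D'.symm Y Z]; abel⟩

theorem diff_eval (D D' : TorsionFreeConnection E M) (Y Z : Vect E M) :
    (diff D D').1.eval Y Z = D.nabla Y Z - D'.nabla Y Z := by
  dsimp only [diff]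
  rw [Tensor12.mk_eval]

/-- Torsion-free connections form an affine space modelled on the symmetric tensor fields of type
`(1,2)`. -/
instance instAddTorsor : AddTorsor (SymTensor E M) (TorsionFreeConnection E M) where
  vadd S D :=
    { nabla := fun Y Z => S.1.eval Y Z + D.nabla Y Z
      add_left := fun Y Y' Z => by rw [Tensor12.eval_add_left, D.add_left]; abel
      fsmul_left := fun f Y Z => by rw [Tensor12.eval_fsmul_left, D.fsmul_left, smul_add]
      add_right := fun Y Z Z' => by rw [Tensor12.eval_add_right, D.add_right]; abel
      leibniz := fun Y f Z => by rw [Tensor12.eval_fsmul_right, D.leibniz, smul_add]; abel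
      torsion_free := fun Y Z => by
        rw [(symm_iff _).1 S.2 Y Z, ← D.torsion_free]; abel }
  zero_vadd D := by
    ext Y Z : 3
    exact zero_add (D.nabla Y Z)
  add_vadd S T D := by
    ext Y Z : 3
    exact add_assoc (S.1.eval Y Z) (T.1.eval Y Z) (D.nabla Y Z)
  vsub := diff
  nonempty := instNonempty
  vsub_vadd' D D' := by
    ext Y Z : 3
    exact (congrArg (· + D'.nabla Y Z) (diff_eval D D' Y Z)).trans
      (sub_add_cancel (D.nabla Y Z) (D'.nabla Y Z))
  vadd_vsub' S D := by
    apply Subtype.ext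
    apply Tensor12.ext_eval
    intro Y Z
    exact (diff_eval _ _ Y Z).trans (add_sub_cancel_right (S.1.eval Y Z) (D.nabla Y Z))

theorem vadd_nabla (S : SymTensor E M) (D : TorsionFreeConnection E M) (Y Z : Vect E M) :
    (S +ᵥ D).nabla Y Z = S.1.eval Y Z + D.nabla Y Z := rfl

theorem vsub_eval (D D' : TorsionFreeConnection E M) (Y Z : Vect E M) :
    (D -ᵥ D').1.eval Y Z = D.nabla Y Z - D'.nabla Y Z := diff_eval D D' Y Z

/-- The Lie derivative of a connection,
`(L_X ∇)(Y, Z) = [X, ∇_Y Z] - ∇_{[X, Y]} Z - ∇_Y [X, Z]`. -/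
def lieDeriv (X : Vect E M) (D : TorsionFreeConnection E M) : SymTensor E M :=
  ⟨Tensor12.mk (fun Y Z => ⁅X, D.nabla Y Z⁆ - D.nabla ⁅X, Y⁆ Z - D.nabla Y ⁅X, Z⁆)
    (fun Y Y' Z => by simp only [D.add_left, lie_add]; abel)
    (fun f Y Z => by
      simp only [D.fsmul_left, bracket_fsmul, D.add_left]; module)
    (fun Y Z Z' => by simp only [D.add_right, lie_add]; abel)
    (fun f Y Z => by
      simp only [bracket_fsmul, D.leibniz, D.add_right, lie_add, dirDeriv_bracket]; module),
  (symm_iff _).2 fun Y Z => by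
    rw [Tensor12.mk_eval, Tensor12.mk_eval, D.symm Y Z, D.symm ⁅X, Y⁆ Z, D.symm Y ⁅X, Z⁆, lie_add,
      leibniz_lie X Y Z]
    abel⟩

theorem lieDeriv_eval (X : Vect E M) (D : TorsionFreeConnection E M) (Y Z : Vect E M) :
    (lieDeriv X D).1.eval Y Z = ⁅X, D.nabla Y Z⁆ - D.nabla ⁅X, Y⁆ Z - D.nabla Y ⁅X, Z⁆ := by
  dsimp only [lieDeriv]
  rw [Tensor12.mk_eval]

theorem lieDeriv_vadd (X : Vect E M) (S : SymTensor E M) (D : TorsionFreeConnection E M) :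
    lieDeriv X (S +ᵥ D) = ⁅X, S⁆ + lieDeriv X D := by
  apply Subtype.ext
  apply Tensor12.ext_eval
  intro Y Z
  change _ = ((⁅X, S.1⁆ : Tensor12 E M) + (lieDeriv X D).1).eval Y Z
  rw [Tensor12.add_eval, lieDeriv_eval, lieDeriv_eval, Tensor12.lie_eval]
  simp only [vadd_nabla, lie_add]
  abel

/-- The linear map `X ↦ L_X ∇`. -/
def lieCochain (D : TorsionFreeConnection E M) : Vect E M →ₗ[ℝ] SymTensor E M where
  toFun X := lieDeriv X D
  map_add' X X' := by
    apply Subtype.ext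
    apply Tensor12.ext_eval
    intro Y Z
    change _ = ((lieDeriv X D).1 + (lieDeriv X' D).1).eval Y Z
    simp only [Tensor12.add_eval, lieDeriv_eval, add_lie, D.add_left, D.add_right]
    abel
  map_smul' c X := by
    apply Subtype.ext
    apply Tensor12.ext_eval
    intro Y Z
    have h : ∀ W : Vect E M, ⁅c • X, W⁆ = (constFun c : C^∞⟮𝓘(ℝ, E), M; ℝ⟯) • ⁅X, W⁆ :=
      fun W => smul_lie c X W
    have h0 : dirDeriv Y (constFun c : C^∞⟮𝓘(ℝ, E), M; ℝ⟯) = 0 := dirDeriv_const Y c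
    change _ = (c • (lieDeriv X D).1).eval Y Z
    rw [Tensor12.smul_eval, lieDeriv_eval, lieDeriv_eval, h, h, h, D.fsmul_left, D.leibniz, h0,
      zero_smul, zero_add, ← smul_sub, ← smul_sub]
    rfl

theorem lieCochain_apply (D : TorsionFreeConnection E M) (X : Vect E M) :
    D.lieCochain X = lieDeriv X D := rfl

theorem lieCochain_mem (D : TorsionFreeConnection E M) :
    D.lieCochain ∈ oneCocycle (Vect E M) (SymTensor E M) := by
  rw [mem_oneCocycle]
  intro X W
  apply Subtype.ext
  apply Tensor12.ext_eval
  intro Y Z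
  have hsub : ∀ (S T : Tensor12 E M), (S - T).eval Y Z = S.eval Y Z - T.eval Y Z := fun S T => by
    ext x; rfl
  change ((⁅X, (lieDeriv W D).1⁆ : Tensor12 E M) - (⁅W, (lieDeriv X D).1⁆ : Tensor12 E M) -
    (lieDeriv ⁅X, W⁆ D).1).eval Y Z = 0
  simp only [hsub, Tensor12.lie_eval, lieDeriv_eval, lie_sub, lie_lie, D.sub_left, D.sub_right]
  abel

/-- The `1`-cocycle `L_∇ : X ↦ L_X ∇`. -/
def lieCocycle (D : TorsionFreeConnection E M) : oneCocycle (Vect E M) (SymTensor E M) :=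
  ⟨D.lieCochain, D.lieCochain_mem⟩

theorem mk_lieCocycle (D D' : TorsionFreeConnection E M) :
    H1.mk D.lieCocycle = H1.mk D'.lieCocycle := by
  rw [H1.mk_eq_mk]
  refine ⟨D -ᵥ D', ?_⟩
  ext1 X
  have h := lieDeriv_vadd X (D -ᵥ D') D'
  rw [vsub_vadd] at h
  exact (sub_eq_of_eq_add h).symm

end TorsionFreeConnection

end Connections
section ProjectiveStructures

variable (E : Type*) [NormedAddCommGroup E] [NormedSpace ℝ E] [FiniteDimensional ℝ E]
  [CompleteSpace E]
  (M : Type*) [TopologicalSpace M] [ChartedSpace E M] [IsManifold 𝓘(ℝ, E) ∞ M] [T2Space M]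

variable {E M} in
theorem pr_add (S T : SymTensor E M) : pr E M (S + T) = pr E M S + pr E M T :=
  map_add (pr E M : SymTensor E M →ₗ[ℝ] TraceFree E M) S T

variable {E M} in
theorem pr_sub (S T : SymTensor E M) : pr E M (S - T) = pr E M S - pr E M T :=
  map_sub (pr E M : SymTensor E M →ₗ[ℝ] TraceFree E M) S T

variable {E M} in
theorem pr_zero : pr E M (0 : SymTensor E M) = 0 :=
  map_zero (pr E M : SymTensor E M →ₗ[ℝ] TraceFree E M)

variable {E M} in
theorem pr_lie (X : Vect E M) (S : SymTensor E M) : pr E M ⁅X, S⁆ = ⁅X, pr E M S⁆ :=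
  LieModuleHom.map_lie (pr E M) X S

variable [SecondCountableTopology M]

/-- The affine representation of `Vect(M)` on the space of torsion-free connections. -/
def connRep : AffineRep (Vect E M) (SymTensor E M) (TorsionFreeConnection E M) where
  act :=
    { toFun := fun X =>
        { toFun := fun D => D.lieDeriv X
          linear := LieModule.toEnd ℝ (Vect E M) (SymTensor E M) X
          map_vadd' := fun D S => TorsionFreeConnection.lieDeriv_vadd X S D }
      map_add' := fun X Y => AffineMap.ext fun D => map_add D.lieCochain X Y
      map_smul' := fun c X => AffineMap.ext fun D => map_smul D.lieCochain c X }
  act_lie X Y D := mem_oneCocycle.1 D.lieCochain_mem X Y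

variable {E M} in
theorem exists_vsub_eq_iff {D D' : TorsionFreeConnection E M} :
    (∃ α : OneForm E M, D -ᵥ D' = idHom E M α) ↔ pr E M (D -ᵥ D') = 0 :=
  (pr_eq_zero_iff _).symm

/-- Two torsion-free connections are projectively equivalent if their difference is `α𝟙` for some
one-form `α`, that is `∇_Y Z - ∇'_Y Z = α(Y) Z + α(Z) Y`. -/
def projectiveSetoid : Setoid (TorsionFreeConnection E M) where
  r D D' := ∃ α : OneForm E M, D -ᵥ D' = idHom E M α
  iseqv :=
    { refl := fun D => exists_vsub_eq_iff.2 (by rw [vsub_self, pr_zero])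
      symm := fun {D D'} h => exists_vsub_eq_iff.2 (by
        have h := exists_vsub_eq_iff.1 h
        rw [← vsub_sub_vsub_cancel_right D' D D', vsub_self, pr_sub, h, pr_zero, sub_zero])
      trans := fun {D D' D''} h h' => exists_vsub_eq_iff.2 (by
        have h := exists_vsub_eq_iff.1 h
        have h' := exists_vsub_eq_iff.1 h'
        rw [← vsub_add_vsub_cancel D D' D'', pr_add, h, h', add_zero]) }

/-- The space of projective structures on `M`: projective equivalence classes of torsion-free
connections. -/
def ProjectiveStructure : Type _ := Quotient (projectiveSetoid E M)

variable {E M}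

namespace ProjectiveStructure

/-- The projective structure of a torsion-free connection. -/
def mk (D : TorsionFreeConnection E M) : ProjectiveStructure E M :=
  Quotient.mk (projectiveSetoid E M) D

theorem mk_surjective : Function.Surjective (mk : TorsionFreeConnection E M → _) :=
  Quotient.mk_surjective

theorem mk_eq_mk {D D' : TorsionFreeConnection E M} : mk D = mk D' ↔ pr E M (D -ᵥ D') = 0 :=
  Quotient.eq.trans exists_vsub_eq_iff

theorem pr_eq_of_mk_eq {D D' : TorsionFreeConnection E M} (h : mk D = mk D') (S : SymTensor E M) :
    pr E M (S + (D -ᵥ D')) = pr E M S := by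
  rw [pr_add, mk_eq_mk.1 h, add_zero]

/-- Projective structures form an affine space modelled on the trace-free symmetric tensor fields:
`s + [∇] = [s + ∇]` and `[∇] - [∇'] = pr(∇ - ∇')`. -/
instance instAddTorsorProjectiveStructure :
    AddTorsor (TraceFree E M) (ProjectiveStructure E M) where
  vadd s := Quotient.lift (fun D => mk ((s : SymTensor E M) +ᵥ D)) fun D D' h => mk_eq_mk.2 (by
    rw [vadd_vsub_vadd_cancel_left]
    exact exists_vsub_eq_iff.1 h)
  zero_vadd p := by
    obtain ⟨D, rfl⟩ := mk_surjective p
    exact congrArg mk (zero_vadd (SymTensor E M) D)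
  add_vadd s t p := by
    obtain ⟨D, rfl⟩ := mk_surjective p
    exact congrArg mk (add_vadd (s : SymTensor E M) (t : SymTensor E M) D)
  vsub := Quotient.lift₂ (fun D D' => pr E M (D -ᵥ D')) fun D₁ D₂ D₁' D₂' h h' => by
    have h := exists_vsub_eq_iff.1 h
    have h' := exists_vsub_eq_iff.1 h'
    have e : D₁ -ᵥ D₂ = (D₁ -ᵥ D₁') + (D₁' -ᵥ D₂') - (D₂ -ᵥ D₂') := by
      rw [vsub_add_vsub_cancel, vsub_sub_vsub_cancel_right]
    rw [e, pr_sub, pr_add, h, h', zero_add, sub_zero]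
  nonempty := ⟨mk (Classical.arbitrary _)⟩
  vsub_vadd' p q := by
    obtain ⟨D, rfl⟩ := mk_surjective p
    obtain ⟨D', rfl⟩ := mk_surjective q
    refine mk_eq_mk.2 ?_
    change pr E M ((((pr E M (D -ᵥ D') : TraceFree E M) : SymTensor E M) +ᵥ D') -ᵥ D) = 0
    rw [vadd_vsub_assoc, pr_add, pr_traceFree, ← pr_add, vsub_add_vsub_cancel, vsub_self, pr_zero]
  vadd_vsub' s p := by
    obtain ⟨D, rfl⟩ := mk_surjective p
    change pr E M (((s : SymTensor E M) +ᵥ D) -ᵥ D) = s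
    rw [vadd_vsub, pr_traceFree]

theorem vadd_mk (s : TraceFree E M) (D : TorsionFreeConnection E M) :
    s +ᵥ mk D = mk ((s : SymTensor E M) +ᵥ D) := rfl

theorem mk_vsub_mk (D D' : TorsionFreeConnection E M) : mk D -ᵥ mk D' = pr E M (D -ᵥ D') := rfl

/-- The map `[∇] ↦ pr(L_X ∇)`. -/
def act (X : Vect E M) : ProjectiveStructure E M → TraceFree E M :=
  Quotient.lift (fun D => pr E M (D.lieDeriv X)) fun D D' h => by
    have h := exists_vsub_eq_iff.1 h
    rw [← vsub_vadd D D', TorsionFreeConnection.lieDeriv_vadd, pr_add, pr_lie, h, lie_zero,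
      zero_add]

theorem act_mk (X : Vect E M) (D : TorsionFreeConnection E M) :
    act X (mk D) = pr E M (D.lieDeriv X) := rfl

theorem act_vadd (X : Vect E M) (s : TraceFree E M) (p : ProjectiveStructure E M) :
    act X (s +ᵥ p) = ⁅X, s⁆ + act X p := by
  obtain ⟨D, rfl⟩ := mk_surjective p
  rw [vadd_mk, act_mk, act_mk, TorsionFreeConnection.lieDeriv_vadd, pr_add, pr_lie, pr_traceFree]

theorem act_add (X Y : Vect E M) (p : ProjectiveStructure E M) :
    act (X + Y) p = act X p + act Y p := by
  obtain ⟨D, rfl⟩ := mk_surjective p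
  rw [act_mk, act_mk, act_mk, ← pr_add]
  exact congrArg (pr E M) (map_add D.lieCochain X Y)

theorem act_smul (c : ℝ) (X : Vect E M) (p : ProjectiveStructure E M) :
    act (c • X) p = c • act X p := by
  obtain ⟨D, rfl⟩ := mk_surjective p
  rw [act_mk, act_mk]
  exact (congrArg (pr E M) (map_smul D.lieCochain c X)).trans
    (map_smul (pr E M : SymTensor E M →ₗ[ℝ] TraceFree E M) _ _)

theorem act_lie (X Y : Vect E M) (p : ProjectiveStructure E M) :
    ⁅X, act Y p⁆ - ⁅Y, act X p⁆ - act ⁅X, Y⁆ p = 0 := by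
  obtain ⟨D, rfl⟩ := mk_surjective p
  rw [act_mk, act_mk, act_mk, ← pr_lie, ← pr_lie, ← pr_sub, ← pr_sub]
  exact (congrArg (pr E M) (mem_oneCocycle.1 D.lieCochain_mem X Y)).trans pr_zero

/-- The map `[∇] ↦ pr(L_X ∇)`, as an affine map. -/
def actAffine (X : Vect E M) : ProjectiveStructure E M →ᵃ[ℝ] TraceFree E M where
  toFun := act X
  linear := LieModule.toEnd ℝ (Vect E M) (TraceFree E M) X
  map_vadd' p s := act_vadd X s p

end ProjectiveStructure

variable (E M) in
/-- The affine representation of `Vect(M)` on the space of projective structures, pushed down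
from the space of torsion-free connections: `X.[∇] = pr(L_X ∇)`. -/
def projRep : AffineRep (Vect E M) (TraceFree E M) (ProjectiveStructure E M) where
  act :=
    { toFun := ProjectiveStructure.actAffine
      map_add' := fun X Y => AffineMap.ext (ProjectiveStructure.act_add X Y)
      map_smul' := fun c X => AffineMap.ext (ProjectiveStructure.act_smul c X) }
  act_lie := ProjectiveStructure.act_lie

theorem projRep_act (X : Vect E M) (D : TorsionFreeConnection E M) :
    (projRep E M).act X (ProjectiveStructure.mk D) = pr E M ((connRep E M).act X D) := rfl

end ProjectiveStructures

section Classes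

variable (E : Type*) [NormedAddCommGroup E] [NormedSpace ℝ E] [FiniteDimensional ℝ E]
  [CompleteSpace E]
  (M : Type*) [TopologicalSpace M] [ChartedSpace E M] [IsManifold 𝓘(ℝ, E) ∞ M] [T2Space M]
  [SecondCountableTopology M]

/-- The class of the cocycles `L_∇`; it does not depend on the torsion-free connection `∇`. -/
def lieClass : H1 (Vect E M) (SymTensor E M) :=
  H1.mk (Classical.arbitrary (TorsionFreeConnection E M)).lieCocycle

/-- The image of the class of the cocycles `L_∇` under the map induced by `pr` in cohomology. -/
def prLieClass : H1 (Vect E M) (TraceFree E M) := H1.map (pr E M) (lieClass E M)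

variable {E M} in
/-- The cocycle `pr ∘ L_∇`, with values in the trace-free tensor fields. -/
def prLieCocycle (D : TorsionFreeConnection E M) : oneCocycle (Vect E M) (TraceFree E M) :=
  cocycleMap (pr E M) D.lieCocycle

variable {E M} in
/-- The cocycle `pr ∘ L_∇`, viewed as a cocycle with values in all symmetric tensor fields. -/
def symPrLieCocycle (D : TorsionFreeConnection E M) : oneCocycle (Vect E M) (SymTensor E M) :=
  cocycleMap (TraceFree E M).incl (prLieCocycle D)

/-- The class of the cocycles `pr ∘ L_∇`, viewed as cocycles with values in all symmetric tensor
fields; it does not depend on the torsion-free connection `∇`. -/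
def symPrLieClass : H1 (Vect E M) (SymTensor E M) :=
  H1.mk (symPrLieCocycle (Classical.arbitrary (TorsionFreeConnection E M)))

variable {E M}

theorem mk_lieCocycle_eq (D : TorsionFreeConnection E M) :
    H1.mk D.lieCocycle = lieClass E M := TorsionFreeConnection.mk_lieCocycle _ _

theorem mk_prLieCocycle_eq (D : TorsionFreeConnection E M) :
    H1.mk (prLieCocycle D) = prLieClass E M :=
  congrArg (H1.map (pr E M)) (mk_lieCocycle_eq D)

theorem mk_symPrLieCocycle_eq (D : TorsionFreeConnection E M) :
    H1.mk (symPrLieCocycle D) = symPrLieClass E M :=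
  congrArg (fun c => H1.map (TraceFree E M).incl (H1.map (pr E M) c))
    (TorsionFreeConnection.mk_lieCocycle D _)

theorem prLieCocycle_apply (D : TorsionFreeConnection E M) (X : Vect E M) :
    (prLieCocycle D).1 X = pr E M (D.lieDeriv X) := rfl

theorem symPrLieCocycle_apply (D : TorsionFreeConnection E M) (X : Vect E M) :
    (symPrLieCocycle D).1 X = (pr E M (D.lieDeriv X) : SymTensor E M) := rfl

/-- The map from projective structures to the class of the cocycles `pr ∘ L_∇` is the one induced
by `∇ ↦ pr ∘ L_∇`. -/
def IsInduced (g : ProjectiveStructure E M → CocycleClass (prLieClass E M)) : Prop :=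
  ∀ (D : TorsionFreeConnection E M) (X : Vect E M),
    (g (ProjectiveStructure.mk D)).cochain X = pr E M (D.lieDeriv X)

end Classes

section Naturality

variable {E : Type*} [NormedAddCommGroup E] [NormedSpace ℝ E] [FiniteDimensional ℝ E]
  [CompleteSpace E]
  {M : Type*} [TopologicalSpace M] [ChartedSpace E M] [IsManifold 𝓘(ℝ, E) ∞ M] [T2Space M]
  [SecondCountableTopology M]
  {N : Type*} [TopologicalSpace N] [ChartedSpace E N] [IsManifold 𝓘(ℝ, E) ∞ N] [T2Space N]
  [SecondCountableTopology N]

/-- Two vector fields are related by `Φ`. -/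
def VectRelated (Φ : M → N) (X : Vect E M) (X' : Vect E N) : Prop :=
  ∀ x, mfderiv 𝓘(ℝ, E) 𝓘(ℝ, E) Φ x (X x) = X' (Φ x)

/-- Two tensor fields are related by `Φ`. -/
def TensorRelated (Φ : M → N) (S : Tensor12 E M) (S' : Tensor12 E N) : Prop :=
  ∀ x u v, mfderiv 𝓘(ℝ, E) 𝓘(ℝ, E) Φ x (S x u v) =
    S' (Φ x) (mfderiv 𝓘(ℝ, E) 𝓘(ℝ, E) Φ x u) (mfderiv 𝓘(ℝ, E) 𝓘(ℝ, E) Φ x v)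

/-- Two connections are related by `Φ`: for a local diffeomorphism `Φ`, this says that `∇` is the
pull-back of `∇'`. -/
def ConnRelated (Φ : M → N) (D : TorsionFreeConnection E M) (D' : TorsionFreeConnection E N) :
    Prop :=
  ∀ (Y Z : Vect E M) (Y' Z' : Vect E N), VectRelated Φ Y Y' → VectRelated Φ Z Z' →
    VectRelated Φ (D.nabla Y Z) (D'.nabla Y' Z')

/-- Two projective structures are related by `Φ`. -/
def ProjRelated (Φ : M → N) (p : ProjectiveStructure E M) (p' : ProjectiveStructure E N) : Prop :=
  ∃ D D', ProjectiveStructure.mk D = p ∧ ProjectiveStructure.mk D' = p' ∧ ConnRelated Φ D D'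

/-- Two cochains with values in the trace-free tensor fields are related by `Φ`. -/
def CochainRelated (Φ : M → N) (γ : Vect E M →ₗ[ℝ] TraceFree E M)
    (γ' : Vect E N →ₗ[ℝ] TraceFree E N) : Prop :=
  ∀ X X', VectRelated Φ X X' → TensorRelated Φ (γ X).1.1 (γ' X').1.1

end Naturality
end ProjAff

end

open ProjAff

/-! For (1), formula `L_X(∇ + s) = L_X ∇ + L_X s`, taken modulo tensors `α𝟙`, says that moving `[∇]`
by a trace-free `s` changes the cocycle `pr ∘ L_∇` by the coboundary `∂s`. So `[∇] ↦ pr ∘ L_∇` is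
affine with linear part `∂`. It intertwines because the action on a class is `x.γ = ∂(γ(x))`, and
`γ(x)` is here the value `x.[∇]` of the action on projective structures. Naturality holds because
`L_X ∇` is built from brackets and `∇`, which respect `Φ`-relatedness, and `pr` is built from the
trace, which is invariant under conjugation by `dΦ`.

For (2), the equivalence is `([∇], α) ↦ pr ∘ L_∇ + ∂(α𝟙)`, with linear part `(s, α) ↦ ∂(s + α𝟙)`. An
affine map is bijective exactly when its linear part is. The map `(s, α) ↦ s + α𝟙` is bijective by
the splitting `S = pr S + (1/(m+1)) tr(S)𝟙` (`symOfProd_bijective`), and `∂` is onto the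
coboundaries by definition. What remains is the injectivity of `∂`: no nonzero symmetric tensor
field of type `(1,2)` is invariant under all vector fields (`SymTensor.eq_zero_of_lie_eq_zero`).

That vanishing comes from the failure of `X ↦ L_X S` to be linear over functions
(`Tensor12.fsmul_lie_eval`). If `S` is invariant, evaluating `L_{fX} S` on `(X, X)` leaves
`(S(X,X)f) X = 2 (Xf) S(X,X)`. Differentiating `f` along both sides gives `ab = 2ab` with `a =
S(X,X)f` and `b = Xf`. Where `b ≠ 0` this forces `a = 0`, hence `S(X,X) = 0`; polarization finishes
the proof. -/

noncomputable section

set_option linter.unusedSectionVars false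

namespace ProjAff

/-! ### Symmetric tensor fields of type `(1,2)` invariant under all vector fields. -/

section Invariants

variable {E : Type*} [NormedAddCommGroup E] [NormedSpace ℝ E] [FiniteDimensional ℝ E]
  {M : Type*} [TopologicalSpace M] [ChartedSpace E M] [IsManifold 𝓘(ℝ, E) ∞ M] [T2Space M]

/-- A nonzero tangent vector is detected by the differential of a global smooth function. -/
theorem exists_dirDeriv_ne_zero {x : M} {X : Vect E M} (hX : X x ≠ 0) :
    ∃ f : C^∞⟮𝓘(ℝ, E), M; ℝ⟯, dirDeriv X f x ≠ 0 := by
  obtain ⟨φ⟩ : Nonempty (SmoothBumpFunction 𝓘(ℝ, E) x) := inferInstance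
  -- The chart at `x`, cut off by a bump function, is a global smooth map to `E` with invertible
  -- differential at `x`. It therefore does not kill `X x`, and a linear form on `E` turns it into
  -- the required function.
  have hφ : ContMDiff 𝓘(ℝ, E) 𝓘(ℝ, E) ∞ fun y => φ y • extChartAt 𝓘(ℝ, E) x y :=
    φ.contMDiff_smul contMDiffOn_extChartAt
  have heq : (fun y => φ y • extChartAt 𝓘(ℝ, E) x y) =ᶠ[𝓝 x] extChartAt 𝓘(ℝ, E) x := by
    filter_upwards [φ.eventuallyEq_one] with y hy
    have : φ y = 1 := hy
    rw [this, one_smul]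
  have hne : mvfderiv 𝓘(ℝ, E) (fun y => φ y • extChartAt 𝓘(ℝ, E) x y) x (X x) ≠ 0 := by
    intro h
    have h' : mfderiv 𝓘(ℝ, E) 𝓘(ℝ, E) (fun y => φ y • extChartAt 𝓘(ℝ, E) x y) x (X x) = 0 := h
    have hinv : (mfderiv 𝓘(ℝ, E) 𝓘(ℝ, E) (fun y => φ y • extChartAt 𝓘(ℝ, E) x y) x).IsInvertible := by
      rw [heq.mfderiv_eq]
      exact isInvertible_mfderiv_extChartAt (mem_extChartAt_source x)
    exact hX (hinv.injective (h'.trans (map_zero _).symm))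
  obtain ⟨l, hl⟩ := SeparatingDual.exists_ne_zero (R := ℝ) hne
  refine ⟨⟨fun y => l (φ y • extChartAt 𝓘(ℝ, E) x y), l.contMDiff.comp hφ⟩, ?_⟩
  -- Chain rule: a continuous linear form is its own derivative, so the derivative of the composite
  -- along `X` at `x` is `l` applied to the vector of `hne`, nonzero by `hl`.
  have h := mvfderiv_comp_apply x (g := l) (l.mdifferentiableAt)
    (hφ.mdifferentiable (by simp) x) (X x)
  intro h0
  refine hl (Eq.trans ?_ (h.symm.trans h0))
  nth_rw 2 [mvfderiv]
  rw [mfderiv_eq_fderiv, l.fderiv]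
  rfl

variable [CompleteSpace E]

/-- The Lie derivative of a tensor field along `f X`. -/
theorem Tensor12.fsmul_lie_eval (f : C^∞⟮𝓘(ℝ, E), M; ℝ⟯) (X : Vect E M) (S : Tensor12 E M)
    (Y Z : Vect E M) :
    (⁅f • X, S⁆ : Tensor12 E M).eval Y Z = f • (⁅X, S⁆ : Tensor12 E M).eval Y Z -
      dirDeriv (S.eval Y Z) f • X + dirDeriv Y f • S.eval X Z + dirDeriv Z f • S.eval Y X := by
  -- Negatives enter through `[fX, W] = -(Wf) X + f [X, W]`; compatibility of `S` with them follows
  -- from additivity alone.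
  have neg_left : ∀ Y Z, S.eval (-Y) Z = - S.eval Y Z := fun Y Z =>
    map_neg (AddMonoidHom.mk' (fun Y => S.eval Y Z) fun Y Y' => S.eval_add_left Y Y' Z) Y
  have neg_right : ∀ Y Z, S.eval Y (-Z) = - S.eval Y Z := fun Y Z =>
    map_neg (AddMonoidHom.mk' (S.eval Y) (S.eval_add_right Y)) Z
  simp only [Tensor12.lie_eval, fsmul_bracket, eval_add_left, eval_add_right, neg_left, neg_right,
    eval_fsmul_left, eval_fsmul_right]
  module

/-- A symmetric tensor field of type `(1,2)` that is invariant under all vector fields vanishes. -/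
theorem SymTensor.eq_zero_of_lie_eq_zero (S : SymTensor E M) (h : ∀ X : Vect E M, ⁅X, S⁆ = 0) :
    S = 0 := by
  have h' : ∀ X Y Z : Vect E M, (⁅X, S.1⁆ : Tensor12 E M).eval Y Z = 0 := by
    intro X Y Z
    have hX : ⁅X, S.1⁆ = 0 := congrArg Subtype.val (h X)
    rw [hX]
    rfl
  have diag : ∀ (X : Vect E M) (x : M), S.1.eval X X x = 0 := by
    intro X x
    -- At a zero of `X` no function has nonzero derivative along `X`, but there the claim is
    -- immediate since `S` is tensorial.
    by_cases hx : X x = 0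
    · rw [Tensor12.eval_apply, hx, map_zero]
    obtain ⟨f, hf⟩ := exists_dirDeriv_ne_zero hx
    -- With all arguments equal to `X` and both Lie derivatives zero, only the terms in the
    -- derivatives of `f` survive: `(S(X,X)f) X = 2 (Xf) S(X,X)`.
    have key := S.1.fsmul_lie_eval f X X X
    rw [h', h'] at key
    have key' : dirDeriv (S.1.eval X X) f • X =
        dirDeriv X f • S.1.eval X X + dirDeriv X f • S.1.eval X X := by
      linear_combination (norm := module) key
    -- Differentiating the same `f` along both sides makes the identity scalar: `ab = 2ba` with `a =
    -- S(X,X)f` and `b = Xf ≠ 0` at `x`, so `a = 0`.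
    have key1 := congrArg (fun W => dirDeriv W f x) key'
    simp only [add_dirDeriv, fsmul_dirDeriv] at key1
    have key2 : dirDeriv (S.1.eval X X) f x * dirDeriv X f x =
        dirDeriv X f x * dirDeriv (S.1.eval X X) f x +
          dirDeriv X f x * dirDeriv (S.1.eval X X) f x := key1
    have h0 : dirDeriv (S.1.eval X X) f x = 0 :=
      (mul_eq_zero.1 (by linarith : dirDeriv X f x * dirDeriv (S.1.eval X X) f x = 0)).resolve_left hf
    -- Back in the vector identity at `x`, the left side now vanishes and `2 (Xf) S(X,X) = 0`
    -- remains.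
    have key3 : dirDeriv (S.1.eval X X) f x • X x =
        dirDeriv X f x • S.1.eval X X x + dirDeriv X f x • S.1.eval X X x :=
      congrArg (fun W : Vect E M => W x) key'
    rw [h0, zero_smul, ← add_smul, ← two_mul] at key3
    exact (smul_eq_zero.1 key3.symm).resolve_left (mul_ne_zero two_ne_zero hf)
  apply Subtype.ext
  apply Tensor12.ext_eval
  intro Y Z
  have hYZ := (symm_iff _).1 S.2 Y Z
  ext x
  -- Polarization: by symmetry, the value of `S` on `(Y + Z, Y + Z)` is twice its value on `(Y, Z)`,
  -- up to diagonal terms, which are zero.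
  have h1 := diag (Y + Z) x
  rw [Tensor12.eval_add_left, Tensor12.eval_add_right, Tensor12.eval_add_right, ← hYZ] at h1
  have h2 : S.1.eval Y Y x + S.1.eval Y Z x + (S.1.eval Y Z x + S.1.eval Z Z x) = 0 := h1
  rw [diag, diag, zero_add, add_zero, ← two_smul ℝ] at h2
  exact (smul_eq_zero.1 h2).resolve_left two_ne_zero

/-- The kernel of `∂` consists of the invariant tensor fields. Hence a coboundary has only one
primitive, which is what makes the map of part (2) injective. -/
theorem coboundary₀_symTensor_injective :
    Function.Injective (coboundary₀ (Vect E M) (SymTensor E M)) := by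
  rw [← LinearMap.ker_eq_bot, LinearMap.ker_eq_bot']
  intro S hS
  exact SymTensor.eq_zero_of_lie_eq_zero S fun X => LinearMap.congr_fun hS X

end Invariants

/-! ### The induced affine maps: first `[∇] ↦ pr ∘ L_∇`. -/

section InducedMaps

variable {E : Type*} [NormedAddCommGroup E] [NormedSpace ℝ E] [FiniteDimensional ℝ E]
  [CompleteSpace E]
  {M : Type*} [TopologicalSpace M] [ChartedSpace E M] [IsManifold 𝓘(ℝ, E) ∞ M] [T2Space M]
  [SecondCountableTopology M]

theorem CocycleClass.ext {L V : Type*} [LieRing L] [LieAlgebra ℝ L] [AddCommGroup V] [Module ℝ V]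
    [LieRingModule L V] [LieModule ℝ L V] {c : H1 L V} {γ γ' : CocycleClass c}
    (h : γ.cochain = γ'.cochain) : γ = γ' :=
  Subtype.ext (Subtype.ext h)

namespace ProjectiveStructure

/-- The cochain `X ↦ pr (L_X ∇)` of a projective structure `[∇]`. -/
def cochain (p : ProjectiveStructure E M) : Vect E M →ₗ[ℝ] TraceFree E M where
  toFun X := act X p
  map_add' X Y := act_add X Y p
  map_smul' c X := act_smul c X p

/-- This identifies `∂` as the linear part of `[∇] ↦ pr ∘ L_∇`. -/
theorem cochain_vadd (s : TraceFree E M) (p : ProjectiveStructure E M) :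
    (s +ᵥ p).cochain = coboundary₀ (Vect E M) (TraceFree E M) s + p.cochain :=
  LinearMap.ext fun X => act_vadd X s p

/-- The cocycle `X ↦ pr (L_X ∇)` of a projective structure `[∇]`, in its class. -/
def toClass (p : ProjectiveStructure E M) : CocycleClass (prLieClass E M) :=
  -- For any representative `D` the cochain is by definition `prLieCocycle D`, so the cocycle
  -- condition and the class are inherited from it.
  ⟨⟨p.cochain, by obtain ⟨D, rfl⟩ := mk_surjective p; exact (prLieCocycle D).2⟩, by
    obtain ⟨D, rfl⟩ := mk_surjective p; exact mk_prLieCocycle_eq D⟩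

/-- The affine map `[∇] ↦ pr ∘ L_∇`. -/
def toClassAffine : ProjectiveStructure E M →ᵃ[ℝ] CocycleClass (prLieClass E M) where
  toFun := toClass
  linear := (coboundary₀ (Vect E M) (TraceFree E M)).rangeRestrict
  map_vadd' p s := CocycleClass.ext (cochain_vadd s p)

theorem toClassAffine_isInduced : IsInduced (toClassAffine : ProjectiveStructure E M →ᵃ[ℝ] _) :=
  fun _ _ => rfl

/-- Both sides unfold to `∂(X.p)`: on the class, `X` acts by `∂` of the value at `X`, which is
`X.p`; on the other side `∂` is the linear part of the map. -/
theorem toClassAffine_isIntertwining :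
    AffineRep.IsIntertwining (projRep E M) (classRep (prLieClass E M)) toClassAffine :=
  fun _ _ => rfl

/-! ### The equivalence of part (2), with the one-form restoring the trace part. -/

/-- The cochain `X ↦ pr (L_X ∇) + L_X (α𝟙)`, with values in all symmetric tensor fields. -/
def symCochain (p : ProjectiveStructure E M) (α : OneForm E M) :
    Vect E M →ₗ[ℝ] SymTensor E M :=
  coboundary₀ (Vect E M) (SymTensor E M) (idHom E M α) +
    ((TraceFree E M).incl : TraceFree E M →ₗ[ℝ] SymTensor E M) ∘ₗ p.cochain

/-- This identifies `(s, β) ↦ ∂(s + β𝟙)` as the linear part of `([∇], α) ↦ pr ∘ L_∇ + ∂(α𝟙)`. -/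
theorem symCochain_vadd (s : TraceFree E M) (β : OneForm E M) (p : ProjectiveStructure E M)
    (α : OneForm E M) : (s +ᵥ p).symCochain (β + α) =
      coboundary₀ (Vect E M) (SymTensor E M) ((s : SymTensor E M) + idHom E M β) +
        p.symCochain α := by
  have h : idHom E M (β + α) = idHom E M β + idHom E M α :=
    map_add (idHom E M : OneForm E M →ₗ[ℝ] SymTensor E M) β α
  rw [symCochain, symCochain, cochain_vadd, h, map_add, map_add, LinearMap.comp_add]
  -- The Lie derivative of trace-free tensors is the restriction of that of symmetric ones, so
  -- inclusion and `∂` commute definitionally.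
  have h' : ((TraceFree E M).incl : TraceFree E M →ₗ[ℝ] SymTensor E M) ∘ₗ
      coboundary₀ (Vect E M) (TraceFree E M) s =
      coboundary₀ (Vect E M) (SymTensor E M) (s : SymTensor E M) := rfl
  rw [h']
  abel

/-- The cocycle `X ↦ pr (L_X ∇) + L_X (α𝟙)`, in the class of the cocycles `pr ∘ L_∇`. -/
def toSymClass (p : ProjectiveStructure E M) (α : OneForm E M) :
    CocycleClass (symPrLieClass E M) :=
  -- For a representative `D` the cochain is `∂(α𝟙)` plus `symPrLieCocycle D`: still a cocycle, and
  -- in the same class.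
  ⟨⟨p.symCochain α, by
    obtain ⟨D, rfl⟩ := mk_surjective p
    exact add_mem (oneCoboundary_le ⟨_, rfl⟩) (symPrLieCocycle D).2⟩, by
    obtain ⟨D, rfl⟩ := mk_surjective p
    refine (H1.mk_eq_mk.2 ⟨idHom E M α, ?_⟩).trans (mk_symPrLieCocycle_eq D)
    exact (add_sub_cancel_right _ _).symm⟩

variable (E M) in
/-- The map `(s, α) ↦ s + α𝟙`. -/
def symOfProd : TraceFree E M × OneForm E M →ₗ[ℝ] SymTensor E M :=
  LinearMap.coprod ((TraceFree E M).incl : TraceFree E M →ₗ[ℝ] SymTensor E M)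
    (idHom E M : OneForm E M →ₗ[ℝ] SymTensor E M)

theorem symOfProd_apply (s : TraceFree E M) (α : OneForm E M) :
    symOfProd E M (s, α) = (s : SymTensor E M) + idHom E M α := rfl

/-- The splitting of symmetric tensors into trace-free part and trace: `pr` fixes trace-free tensors
and kills every `α𝟙`, while `tr(α𝟙) = (m+1)α` recovers `α`. -/
theorem symOfProd_bijective : Function.Bijective (symOfProd E M) := by
  have hm : (Module.finrank ℝ E : ℝ) + 1 ≠ 0 := by positivity
  constructor
  · rw [← LinearMap.ker_eq_bot, LinearMap.ker_eq_bot']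
    rintro ⟨s, α⟩ h
    rw [symOfProd_apply] at h
    have hs : s = 0 := by
      have := congrArg (pr E M) h
      rwa [pr_add, pr_traceFree, pr_idHom, add_zero, pr_zero] at this
    subst hs
    -- Applying `pr` has removed `s`; taking the trace of what is left gives `(m+1)α = 0`.
    have hα : idHom E M α = 0 := (zero_add _).symm.trans h
    have := trHom_idHom α
    rw [hα] at this
    have h0 : trHom E M (0 : SymTensor E M) = 0 :=
      map_zero (trHom E M : SymTensor E M →ₗ[ℝ] OneForm E M)
    rw [h0] at this
    rw [(smul_eq_zero.1 this.symm).resolve_left hm]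
    rfl
  · intro S
    -- The witness comes from the definition of `pr`, read as `S = pr S + (1/(m+1)) tr(S)𝟙`.
    refine ⟨(pr E M S, (1 / ((Module.finrank ℝ E : ℝ) + 1)) • trHom E M S), ?_⟩
    rw [symOfProd_apply, pr_coe, idHom_smul, sub_add_cancel]

/-- The affine map `([∇], α) ↦ pr ∘ L_∇ + ∂(α𝟙)`. -/
def toSymClassAffine :
    ProjectiveStructure E M × OneForm E M →ᵃ[ℝ] CocycleClass (symPrLieClass E M) where
  toFun q := q.1.toSymClass q.2
  linear := (coboundary₀ (Vect E M) (SymTensor E M)).rangeRestrict ∘ₗ symOfProd E M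
  map_vadd' q s := CocycleClass.ext (symCochain_vadd s.1 s.2 q.1 q.2)

/-- Bijectivity can be tested on the linear part, the composite of the splitting with `∂`
corestricted to its range. Surjectivity costs nothing, because the class is modelled on the
coboundaries; injectivity is the absence of invariant tensors. -/
theorem toSymClassAffine_bijective :
    Function.Bijective (toSymClassAffine : ProjectiveStructure E M × OneForm E M →ᵃ[ℝ] _) := by
  have h : Function.Bijective
      ((coboundary₀ (Vect E M) (SymTensor E M)).rangeRestrict ∘ₗ symOfProd E M) := by
    rw [LinearMap.coe_comp]
    refine Function.Bijective.comp ⟨?_, LinearMap.surjective_rangeRestrict _⟩ symOfProd_bijective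
    exact fun S T hST => coboundary₀_symTensor_injective (congrArg Subtype.val hST)
  exact ⟨(AffineMap.linear_injective_iff _).1 h.1, (AffineMap.linear_surjective_iff _).1 h.2⟩

/-- Both sides are `∂` of a tensor: on one side the value `L_X(α𝟙) + pr(L_X ∇)` of the cocycle at
`X`, on the other the image `pr(L_X ∇) + (L_X α)𝟙` of `X.([∇], α)`. They agree by equivariance of `α
↦ α𝟙`. -/
theorem toSymClassAffine_isIntertwining :
    AffineRep.IsIntertwining
      ((projRep E M).prod (AffineRep.ofLieModule (Vect E M) (OneForm E M)))
      (classRep (symPrLieClass E M)) toSymClassAffine := by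
  rintro X ⟨p, α⟩
  apply Subtype.ext
  change coboundary₀ (Vect E M) (SymTensor E M)
      (⁅X, idHom E M α⁆ + ((act X p : TraceFree E M) : SymTensor E M)) =
    coboundary₀ (Vect E M) (SymTensor E M)
      (((act X p : TraceFree E M) : SymTensor E M) + idHom E M ⁅X, α⁆)
  rw [LieModuleHom.map_lie, add_comm]

end ProjectiveStructure

end InducedMaps

/-! ### Naturality under local diffeomorphisms. -/

section LocalDiffeomorphisms

variable {E : Type*} [NormedAddCommGroup E] [NormedSpace ℝ E] [FiniteDimensional ℝ E]
  [CompleteSpace E]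
  {M : Type*} [TopologicalSpace M] [ChartedSpace E M] [IsManifold 𝓘(ℝ, E) ∞ M] [T2Space M]
  [SecondCountableTopology M]
  {N : Type*} [TopologicalSpace N] [ChartedSpace E N] [IsManifold 𝓘(ℝ, E) ∞ N] [T2Space N]
  [SecondCountableTopology N]
  {Φ : M → N}

theorem isInvertible_mfderiv (hΦ : IsLocalDiffeomorph 𝓘(ℝ, E) 𝓘(ℝ, E) ∞ Φ) (x : M) :
    (mfderiv 𝓘(ℝ, E) 𝓘(ℝ, E) Φ x).IsInvertible :=
  ⟨hΦ.mfderivToContinuousLinearEquiv (by simp) x, rfl⟩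

/-- The pull-back of a vector field by a local diffeomorphism. -/
def pullback (hΦ : IsLocalDiffeomorph 𝓘(ℝ, E) 𝓘(ℝ, E) ∞ Φ) (Y : Vect E N) : Vect E M :=
  ⟨VectorField.mpullback 𝓘(ℝ, E) 𝓘(ℝ, E) Φ Y,
    haveI : IsManifold 𝓘(ℝ, E) 1 M := IsManifold.of_le (n := ∞) (by simp)
    haveI : IsManifold 𝓘(ℝ, E) 1 N := IsManifold.of_le (n := ∞) (by simp)
    Y.contMDiff.mpullback_vectorField hΦ.contMDiff (isInvertible_mfderiv hΦ) (by simp)⟩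

/-- Since `dΦ` is invertible at each point, a field on `N` is related to exactly one field on `M`.
Relatedness thus becomes an equation between fields. -/
theorem vectRelated_iff (hΦ : IsLocalDiffeomorph 𝓘(ℝ, E) 𝓘(ℝ, E) ∞ Φ) {X : Vect E M}
    {X' : Vect E N} : VectRelated Φ X X' ↔ VectorField.mpullback 𝓘(ℝ, E) 𝓘(ℝ, E) Φ X' = X := by
  rw [funext_iff]
  refine forall_congr' fun x => ?_
  rw [VectorField.mpullback_apply, (isInvertible_mfderiv hΦ x).inverse_apply_eq]
  exact eq_comm

theorem vectRelated_pullback (hΦ : IsLocalDiffeomorph 𝓘(ℝ, E) 𝓘(ℝ, E) ∞ Φ) (Y : Vect E N) :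
    VectRelated Φ (pullback hΦ Y) Y := (vectRelated_iff hΦ).2 rfl

/-- Pulling back vector fields commutes with the bracket. -/
theorem VectRelated.lie (hΦ : IsLocalDiffeomorph 𝓘(ℝ, E) 𝓘(ℝ, E) ∞ Φ) {X Y : Vect E M}
    {X' Y' : Vect E N} (hX : VectRelated Φ X X') (hY : VectRelated Φ Y Y') :
    VectRelated Φ ⁅X, Y⁆ ⁅X', Y'⁆ := by
  rw [vectRelated_iff hΦ] at *
  have h2 : minSmoothness ℝ 2 ≤ ∞ := by
    rw [minSmoothness_of_isRCLikeNormedField]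
    exact WithTop.coe_le_coe.2 le_top
  have : IsManifold 𝓘(ℝ, E) (minSmoothness ℝ 2) M := IsManifold.of_le (n := ∞) h2
  have : IsManifold 𝓘(ℝ, E) (minSmoothness ℝ 2) N := IsManifold.of_le (n := ∞) h2
  ext x
  rw [bracket_coe, bracket_coe, VectorField.mpullback_mlieBracket (n := ∞) X'.mdifferentiableAt
    Y'.mdifferentiableAt (hΦ.contMDiff x) h2, hX, hY]

theorem VectRelated.sub {X Y : Vect E M} {X' Y' : Vect E N} (hX : VectRelated Φ X X')
    (hY : VectRelated Φ Y Y') : VectRelated Φ (X - Y) (X' - Y') := fun x =>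
  (map_sub (mfderiv 𝓘(ℝ, E) 𝓘(ℝ, E) Φ x) (X x) (Y x)).trans (congrArg₂ (· - ·) (hX x) (hY x))

/-- Tensors are pointwise objects, so testing them on related pairs of fields suffices once every
tangent vector of `M` is the value of a field belonging to such a pair. -/
theorem tensorRelated_of_eval (hΦ : IsLocalDiffeomorph 𝓘(ℝ, E) 𝓘(ℝ, E) ∞ Φ) {S : Tensor12 E M}
    {S' : Tensor12 E N} (h : ∀ (Y Z : Vect E M) (Y' Z' : Vect E N), VectRelated Φ Y Y' →
      VectRelated Φ Z Z' → VectRelated Φ (S.eval Y Z) (S'.eval Y' Z')) : TensorRelated Φ S S' := by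
  have key : ∀ (x : M) (u : TangentSpace 𝓘(ℝ, E) x), ∃ (Y : Vect E M) (Y' : Vect E N),
      VectRelated Φ Y Y' ∧ Y x = u := by
    intro x u
    -- The pair is built from `N`: `dΦ(u)` is extended to a field there, which is then pulled back.
    -- A field on `M` need not be related to any field on `N`.
    refine ⟨_, extend (Φ x) (mfderiv 𝓘(ℝ, E) 𝓘(ℝ, E) Φ x u), vectRelated_pullback hΦ _, ?_⟩
    apply (isInvertible_mfderiv hΦ x).injective
    exact (vectRelated_pullback hΦ _ x).trans (extend_self _ _)
  intro x u v
  obtain ⟨Y, Y', hY, rfl⟩ := key x u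
  obtain ⟨Z, Z', hZ, rfl⟩ := key x v
  rw [hY x, hZ x]
  exact h Y Z Y' Z' hY hZ x

/-- Each of the three terms of `L_X ∇` is made of brackets and covariant derivatives, and both
operations preserve relatedness. -/
theorem ConnRelated.lieDeriv (hΦ : IsLocalDiffeomorph 𝓘(ℝ, E) 𝓘(ℝ, E) ∞ Φ)
    {D : TorsionFreeConnection E M} {D' : TorsionFreeConnection E N} (hD : ConnRelated Φ D D')
    {X : Vect E M} {X' : Vect E N} (hX : VectRelated Φ X X') :
    TensorRelated Φ (D.lieDeriv X).1 (D'.lieDeriv X').1 := by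
  refine tensorRelated_of_eval hΦ fun Y Z Y' Z' hY hZ => ?_
  rw [TorsionFreeConnection.lieDeriv_eval, TorsionFreeConnection.lieDeriv_eval]
  exact ((hX.lie hΦ (hD _ _ _ _ hY hZ)).sub (hD _ _ _ _ (hX.lie hΦ hY) hZ)).sub
    (hD _ _ _ _ hY (hX.lie hΦ hZ))

/-- Relatedness says that the endomorphisms `S(·, v)` and `S'(·, dΦ v)` are conjugate under `dΦ`, so
they have the same trace. -/
theorem TensorRelated.tr_apply (hΦ : IsLocalDiffeomorph 𝓘(ℝ, E) 𝓘(ℝ, E) ∞ Φ) {S : Tensor12 E M}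
    {S' : Tensor12 E N} (h : TensorRelated Φ S S') (x : M) (v : TangentSpace 𝓘(ℝ, E) x) :
    (S'.tr (Φ x) (mfderiv 𝓘(ℝ, E) 𝓘(ℝ, E) Φ x v) : ℝ) = S.tr x v := by
  let e : TangentSpace 𝓘(ℝ, E) x ≃ₗ[ℝ] TangentSpace 𝓘(ℝ, E) (Φ x) :=
    (hΦ.mfderivToContinuousLinearEquiv (by simp) x).toLinearEquiv
  rw [Tensor12.tr_apply, Tensor12.tr_apply, ← LinearMap.trace_conj' (S.slot x v) e]
  congr 1
  ext w
  obtain ⟨u, rfl⟩ := e.surjective w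
  rw [LinearEquiv.conj_apply_apply, e.symm_apply_apply]
  exact (h x u v).symm

/-- Pointwise, `pr` involves only the tensor, its trace and the constant `1/(m+1)`, which is common
to both manifolds because they have the same model space. -/
theorem TensorRelated.pr (hΦ : IsLocalDiffeomorph 𝓘(ℝ, E) 𝓘(ℝ, E) ∞ Φ) {S : SymTensor E M}
    {S' : SymTensor E N} (h : TensorRelated Φ S.1 S'.1) :
    TensorRelated Φ (ProjAff.pr E M S).1.1 (ProjAff.pr E N S').1.1 := by
  intro x u v
  let c : ℝ := 1 / ((Module.finrank ℝ E : ℝ) + 1)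
  let A := mfderiv 𝓘(ℝ, E) 𝓘(ℝ, E) Φ x
  change A (S.1 x u v - c • ((S.1.tr x u : ℝ) • v + (S.1.tr x v : ℝ) • u)) =
    S'.1 (Φ x) (A u) (A v) -
      c • ((S'.1.tr (Φ x) (A u) : ℝ) • A v + (S'.1.tr (Φ x) (A v) : ℝ) • A u)
  rw [map_sub, map_smul, map_add, map_smul, map_smul, h.tr_apply hΦ x u, h.tr_apply hΦ x v, h x u v]

/-- Maps induced by `∇ ↦ pr ∘ L_∇` are natural with respect to local diffeomorphisms. -/
theorem IsInduced.cochainRelated {g : ProjectiveStructure E M → CocycleClass (prLieClass E M)}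
    (hg : IsInduced g) {g' : ProjectiveStructure E N → CocycleClass (prLieClass E N)}
    (hg' : IsInduced g') (hΦ : IsLocalDiffeomorph 𝓘(ℝ, E) 𝓘(ℝ, E) ∞ Φ)
    {p : ProjectiveStructure E M} {p' : ProjectiveStructure E N} (h : ProjRelated Φ p p') :
    CochainRelated Φ (g p).cochain (g' p').cochain := by
  -- An induced map may be computed on any representative, so the related connections themselves can
  -- be used.
  obtain ⟨D, D', rfl, rfl, hD⟩ := h
  intro X X' hX
  rw [hg, hg']
  exact (hD.lieDeriv hΦ hX).pr hΦ

end LocalDiffeomorphisms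

end ProjAff

end

/-- In the naturality clause `g'` ranges over all maps satisfying `IsInduced`. This amounts to `g' =
g_N`, since the condition prescribes the cochain at every class `[∇]`. -/
theorem mainTheorem8 {m : ℕ} (hm : 1 < m) (M : Type*) [TopologicalSpace M]
    [ChartedSpace (EuclideanSpace ℝ (Fin m)) M] [IsManifold (𝓡 m) ∞ M]
    [T2Space M] [SecondCountableTopology M] [ConnectedSpace M] :
    (∃ g : ProjectiveStructure (EuclideanSpace ℝ (Fin m)) M →ᵃ[ℝ]
          CocycleClass (prLieClass (EuclideanSpace ℝ (Fin m)) M),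
        IsInduced g ∧
        AffineRep.IsIntertwining (projRep (EuclideanSpace ℝ (Fin m)) M)
          (classRep (prLieClass (EuclideanSpace ℝ (Fin m)) M)) g ∧
        ∀ (N : Type*) [TopologicalSpace N] [ChartedSpace (EuclideanSpace ℝ (Fin m)) N]
          [IsManifold (𝓡 m) ∞ N] [T2Space N] [SecondCountableTopology N] [ConnectedSpace N]
          (g' : ProjectiveStructure (EuclideanSpace ℝ (Fin m)) N →
            CocycleClass (prLieClass (EuclideanSpace ℝ (Fin m)) N)),
          IsInduced g' →
          ∀ Φ : M → N, IsLocalDiffeomorph (𝓡 m) (𝓡 m) ∞ Φ →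
          ∀ (p : ProjectiveStructure (EuclideanSpace ℝ (Fin m)) M)
            (p' : ProjectiveStructure (EuclideanSpace ℝ (Fin m)) N),
            ProjRelated Φ p p' → CochainRelated Φ (g p).cochain (g' p').cochain) ∧
    AffineRep.Equivalent
      ((projRep (EuclideanSpace ℝ (Fin m)) M).prod
        (AffineRep.ofLieModule (Vect (EuclideanSpace ℝ (Fin m)) M)
          (OneForm (EuclideanSpace ℝ (Fin m)) M)))
      (classRep (symPrLieClass (EuclideanSpace ℝ (Fin m)) M)) :=
  ⟨⟨ProjectiveStructure.toClassAffine, ProjectiveStructure.toClassAffine_isInduced,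
      ProjectiveStructure.toClassAffine_isIntertwining, fun _ _ _ _ _ _ _ _ hg' _ hΦ _ _ h =>
      ProjectiveStructure.toClassAffine_isInduced.cochainRelated hg' hΦ h⟩,
    ProjectiveStructure.toSymClassAffine, ProjectiveStructure.toSymClassAffine_bijective,
    ProjectiveStructure.toSymClassAffine_isIntertwining⟩
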